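/- Let $P(\lambda)=\sum_{j=0}^m\lambda^jA_j$ with $A_j\in\mathbb C^{n\times n}$ and $\operatorname{rank}(A_m)=n$, let $\mu\in\mathbb C$ and let $r\ge 1$ be an integer. Let $\|\cdot\|_2$ be the spectral norm, let $\sigma_{-k}(M)$ be the $k$th smallest singular value of $M$ (counted with multiplicity), and put $$\mathbb M(\mu):=\inf\{\|\Delta\|_2 : \Delta\in\mathbb C^{n\times n},\ \mu \text{ is a root of multiplicity}\ge r \text{ of } \det(P(\lambda)+\Delta)\},$$ where every number counts as a root of infinite multiplicity of the zero polynomial. For $\Gamma=(\gamma_{ik})_{1\le k<i\le r}\in\mathbb C^{r(r-1)/2}$ let $C(\mu,\Gamma)\in\mathbb C^{r\times r}$ be the upper triangular matrix with all diagonal entries equal to $\mu$ and with entry $\gamma_{ki}$ at position $(i,k)$ for $i<k$, and let $$\mathcal Q(\mu,\Gamma,P):=\sum_{j=0}^m\bigl(C(\mu,\Gamma)^j\bigr)^T\otimes A_j\in\mathbb C^{nr\times nr}.$$ Call $\Gamma_*$ optimal if the supremum of $\sigma_{-r}(\mathcal Q(\mu,\Gamma,P))$ over $\Gamma\in\mathbb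 C^{r(r-1)/2}$ is attained at $\Gamma_*$. (a) Suppose that there is an optimal $\Gamma_*$ such that $\sigma:=\sigma_{-r}(\mathcal Q(\mu,\Gamma_*,P))$ is a singular value of multiplicity one of $\mathcal Q(\mu,\Gamma_*,P)$, and such that there are $\mathcal U,\mathcal V\in\mathbb C^{n\times r}$ with $\operatorname{rank}\mathcal V=r$ for which $U=\operatorname{vec}(\mathcal U)$ and $V=\operatorname{vec}(\mathcal V)$ (stacked columns) are unit vectors with $\mathcal Q(\mu,\Gamma_*,P)V=\sigma U$ and $U^*\mathcal Q(\mu,\Gamma_*,P)=\sigma V^*$. Then $$\mathbb M(\mu)=\sup_{\Gamma\in\mathbb C^{r(r-1)/2}}\sigma_{-r}\bigl(\mathcal Q(\mu,\Gamma,P)\bigr).$$ (b) If $r\le n$ and, in case $r>1$, $P'(\mu)$ has rank $n$, then an optimal $\Gamma$ exists. (So attainment of the supremum need not be assumed in that case.) (c) For every $\Gamma$, the matrix $\mathcal Q(\mu,\Gamma,P)$ is block lower triangular: its $n\times n$ submatrix at rows $1+(i-1)n,\dots,in$ and columns $1+(\ell-1)n,\dots,\ell n$ is $$\begin{cases}\displaystyle\sum_{(s_0,s_1,\dots,s_k)}\gamma_{s_1s_0}\gamma_{s_2s_1}\cdots\gamma_{s_ks_{k-1}}\frac{P^{(k)}(\mu)}{k!}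 & i>\ell,\\ P(\mu) & i=\ell,\\ 0 & i<\ell,\end{cases}$$ where the sum is over all strictly increasing sequences (of any length) of positive integers that start with $\ell$ and end with $i$. -/

import Mathlib

open Polynomial Matrix
open scoped ENNReal Kronecker

noncomputable section

namespace MatPolyDist

/-- The matrix polynomial `P(λ) = ∑_{j=0}^m λ^j A_j`, as a matrix with entries in `ℂ[X]`. -/
def matPoly {n m : ℕ} (A : Fin (m + 1) → Matrix (Fin n) (Fin n) ℂ) :
    Matrix (Fin n) (Fin n) ℂ[X] :=
  ∑ j : Fin (m + 1), (X ^ (j : ℕ) : ℂ[X]) • (A j).map (C : ℂ → ℂ[X])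

/-- `P^{(k)}(z)`: the `k`-th derivative (taken entrywise) of a matrix polynomial, evaluated at `z`.
For `k = 0` this is `P(z)`. -/
def derivAt {n : ℕ} (P : Matrix (Fin n) (Fin n) ℂ[X]) (k : ℕ) (z : ℂ) :
    Matrix (Fin n) (Fin n) ℂ :=
  P.map fun p => (derivative^[k] p).eval z

/-- The algebraic multiplicity of `μ` as an eigenvalue of `P`: its multiplicity as a root of
`det P(λ)` (infinite if `det P` is the zero polynomial). -/
def algMult {n : ℕ} (P : Matrix (Fin n) (Fin n) ℂ[X]) (μ : ℂ) : ℕ∞ :=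
  emultiplicity (X - C μ) P.det

/-- The matrix 2-norm (operator norm with respect to the Euclidean norms). -/
def norm2 {n : ℕ} (Δ : Matrix (Fin n) (Fin n) ℂ) : ℝ :=
  ‖Matrix.toEuclideanCLM (n := Fin n) (𝕜 := ℂ) Δ‖

/-- The infimum `𝕄(μ)` of `‖Δ‖₂` over all `Δ ∈ ℂ^{n×n}` such that `P(λ) + Δ` has `μ` as an
eigenvalue of algebraic multiplicity at least `r`; it is taken in `[0,∞]`. -/
def distMult {n m : ℕ} (A : Fin (m + 1) → Matrix (Fin n) (Fin n) ℂ) (r : ℕ) (μ : ℂ) : ℝ≥0∞ :=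
  ⨅ (Δ : Matrix (Fin n) (Fin n) ℂ)
    (_ : (r : ℕ∞) ≤ algMult (matPoly A + Δ.map (C : ℂ → ℂ[X])) μ), ENNReal.ofReal (norm2 Δ)

/-- The parameters `Γ = (γ_{ik})_{i > k}`, that is `ℂ^{r(r-1)/2}`. -/
abbrev Params (r : ℕ) : Type := {p : Fin r × Fin r // p.2 < p.1} → ℂ

/-- The entry `γ_{ik}` of `Γ` for `i > k`, and `0` otherwise. -/
def gam {r : ℕ} (Γ : Params r) (i k : Fin r) : ℂ :=
  if h : k < i then Γ ⟨(i, k), h⟩ else 0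

/-- The upper triangular matrix `C(μ,Γ)` with diagonal `μ_1, …, μ_r` and entry `γ_{ki}` at
position `(i,k)`, `i < k`. -/
def Cmat {r : ℕ} (μ : Fin r → ℂ) (Γ : Params r) : Matrix (Fin r) (Fin r) ℂ :=
  Matrix.of fun i k => if i = k then μ i else gam Γ k i

/-- `𝒬(μ,Γ,P) = ∑_{j=0}^m (C(μ,Γ)^j)ᵀ ⊗ A_j`. The row (or column) index `(i, a)` is the `a`-th
one in the `i`-th block. -/
def Qmat {n m r : ℕ} (A : Fin (m + 1) → Matrix (Fin n) (Fin n) ℂ) (μ : Fin r → ℂ)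
    (Γ : Params r) : Matrix (Fin r × Fin n) (Fin r × Fin n) ℂ :=
  ∑ j : Fin (m + 1), ((Cmat μ Γ ^ (j : ℕ))ᵀ ⊗ₖ A j)

/-- The singular values of a square matrix, with multiplicity, in decreasing order and indexed
from `0` (and `0` beyond the size of the matrix). -/
def singVal {ι : Type*} [Fintype ι] [DecidableEq ι] (M : Matrix ι ι ℂ) (k : ℕ) : ℝ :=
  (Matrix.toEuclideanLin M).singularValues k

/-- `σ_{-k}(M)`: the `k`-th smallest singular value of a square matrix
(for `1 ≤ k ≤` the size of `M`). -/
def sigmaNeg {ι : Type*} [Fintype ι] [DecidableEq ι] (k : ℕ) (M : Matrix ι ι ℂ) : ℝ :=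
  singVal M (Fintype.card ι - k)

/-- The multiplicity of the number `s` as a singular value of a square matrix. -/
def singMult {ι : Type*} [Fintype ι] [DecidableEq ι] (M : Matrix ι ι ℂ) (s : ℝ) : ℕ :=
  Nat.card {k : Fin (Fintype.card ι) // singVal M k = s}

/-- The function `Γ ↦ σ_{-r}(𝒬(μ,Γ,P))`, for all `μ_i` equal to one number `μ`. -/
def sigmaQ {n m : ℕ} (A : Fin (m + 1) → Matrix (Fin n) (Fin n) ℂ) (r : ℕ) (μ : ℂ)
    (Γ : Params r) : ℝ :=
  sigmaNeg r (Qmat A (fun _ => μ) Γ)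

/-- `Γ` is optimal: the supremum of `σ_{-r}(𝒬(μ,·,P))` is attained at `Γ`. -/
def IsOptimal {n m : ℕ} (A : Fin (m + 1) → Matrix (Fin n) (Fin n) ℂ) (r : ℕ) (μ : ℂ)
    (Γ : Params r) : Prop :=
  ∀ Γ' : Params r, sigmaQ A r μ Γ' ≤ sigmaQ A r μ Γ

/-- Multiplicity assumption: the multiplicity of the singular value `σ_{-r}(𝒬(μ,Γ,P))` is one. -/
def MultiplicityAssumption {n m : ℕ} (A : Fin (m + 1) → Matrix (Fin n) (Fin n) ℂ) (r : ℕ) (μ : ℂ)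
    (Γ : Params r) : Prop :=
  singMult (Qmat A (fun _ => μ) Γ) (sigmaQ A r μ Γ) = 1

/-- Linear independence assumption: there is a consistent pair `vec 𝒰`, `vec 𝒱` of unit left and
right singular vectors of `𝒬(μ,Γ,P)` for `σ_{-r}(𝒬(μ,Γ,P))`, where `𝒰, 𝒱 ∈ ℂ^{n×r}` and `vec`
stacks the columns, such that `rank 𝒱 = r`. -/
def LinIndepAssumption {n m : ℕ} (A : Fin (m + 1) → Matrix (Fin n) (Fin n) ℂ) (r : ℕ) (μ : ℂ)
    (Γ : Params r) : Prop :=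
  ∃ U V : Matrix (Fin n) (Fin r) ℂ,
    star U.vec ⬝ᵥ U.vec = 1 ∧ star V.vec ⬝ᵥ V.vec = 1 ∧
    Qmat A (fun _ => μ) Γ *ᵥ V.vec = (sigmaQ A r μ Γ : ℂ) • U.vec ∧
    star U.vec ᵥ* Qmat A (fun _ => μ) Γ = (sigmaQ A r μ Γ : ℂ) • star V.vec ∧
    V.rank = r

/-- The `n × n` submatrix in block row `i` and block column `l`. -/
def block {n r : ℕ} (M : Matrix (Fin r × Fin n) (Fin r × Fin n) ℂ) (i l : Fin r) :
    Matrix (Fin n) (Fin n) ℂ :=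
  Matrix.of fun a b => M (i, a) (l, b)

open Classical in
/-- The increasing sequences `(s_0, s_1, …, s_k)` in `{1, …, r}` with `s_0 = l` and `s_k = i`. -/
def incSeqs {r : ℕ} (l i : Fin r) (k : ℕ) : Finset (Fin (k + 1) → Fin r) :=
  Finset.univ.filter fun s => StrictMono s ∧ s 0 = l ∧ s (Fin.last k) = i

/-- `∑_{(s_0,…,s_k)} γ_{s_1 s_0} γ_{s_2 s_1} ⋯ γ_{s_k s_{k-1}} P^{(k)}(μ)/k!`, the sum being over
all increasing sequences, of any length, that start with `l` and end with `i`
(their length `k + 1` is at most `r`). -/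
def offDiagBlock {n r : ℕ} (P : Matrix (Fin n) (Fin n) ℂ[X]) (μ : ℂ) (Γ : Params r)
    (i l : Fin r) : Matrix (Fin n) (Fin n) ℂ :=
  ∑ k ∈ Finset.range r, ∑ s ∈ incSeqs l i k,
    (∏ t : Fin k, gam Γ (s t.succ) (s t.castSucc)) • ((k.factorial : ℂ)⁻¹ • derivAt P k μ)

end MatPolyDist

end

/-! Lower bound. Entrywise application of `p ↦ p(C(μ,Γ))ᵀ` is a ring homomorphism on matrix
polynomials, sending `P` to `𝒬` and a constant `Δ` to `I ⊗ Δ`. Reduce `P + Δ` to diagonal form over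
`ℂ[X]`. If `(X - μ)^r` divides the determinant, powers `(X - μ)^κ_b` with `∑ κ_b = r` divide the
diagonal entries. Since `C - μ` is strictly triangular, each such power kills `κ_b` columns, so `𝒬 +
I ⊗ Δ` has a kernel of dimension at least `r`. There `‖𝒬x‖ = ‖(I ⊗ Δ)x‖ ≤ ‖Δ‖‖x‖`, and min-max gives
`σ_{-r}(𝒬) ≤ ‖Δ‖` (`sigmaQ_le_norm2`).

Upper bound. At an optimal `Γ` take `Δ = -σ U V⁺` with `V⁺ = (V*V)⁻¹V*`. The singular vector
equation makes `(V, C)` an invariant pair of `P + Δ`, so the characteristic polynomial `(X - μ)^r`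
of `C` divides the determinant (`pow_dvd_det_of_invariant_pair`). For `‖Δ‖ ≤ σ` it suffices that
`U*U = V*V`. A simple positive singular value has first-order variation `Re tr(SN)` when `C` moves
in direction `N`, so optimality makes `S` upper triangular. A telescoping sum gives `CS - SC = σ(V*V
- U*U)`; the left side is strictly upper triangular and the right side Hermitian, so both vanish
(`gram_eq_gram_of_sensitivity`).

Attainment. When `σ_{-r}` stays above some `ε > 0`, the entries of `Γ` are bounded one superdiagonal
at a time. A large entry on the first uncontrolled superdiagonal makes a block close to a large
multiple of `P'(μ)`, which yields an `n`-dimensional space of nearly annihilated vectors; since `n ≥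
r`, `σ_{-r}` is then small. Superlevel sets are thus bounded, and continuity gives a maximum.

The block formula is Taylor's formula for `p(μ + N)`, the entries of `N^k` being sums over
increasing paths. -/

namespace LinearMap

/-! ### Min-max characterization of singular values. -/

variable {E : Type*} [NormedAddCommGroup E] [InnerProductSpace ℂ E] [FiniteDimensional ℂ E]

/-- An orthonormal basis of right singular vectors of an endomorphism. -/
noncomputable def rightSingularBasis (T : E →ₗ[ℂ] E) :
    OrthonormalBasis (Fin (Module.finrank ℂ E)) ℂ E :=
  T.isSymmetric_adjoint_comp_self.eigenvectorBasis rfl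

theorem adjoint_apply_rightSingularBasis (T : E →ₗ[ℂ] E) (i : Fin (Module.finrank ℂ E)) :
    T.adjoint (T (T.rightSingularBasis i)) =
      ((T.singularValues i : ℂ) ^ 2) • T.rightSingularBasis i := by
  have h := T.isSymmetric_adjoint_comp_self.apply_eigenvectorBasis rfl i
  rw [← T.sq_singularValues_fin rfl i, LinearMap.comp_apply] at h
  rw [rightSingularBasis, h]
  norm_cast

theorem norm_apply_sq_eq_sum (T : E →ₗ[ℂ] E) (x : E) :
    ‖T x‖ ^ 2 = ∑ i : Fin (Module.finrank ℂ E),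
      T.singularValues i ^ 2 * ‖T.rightSingularBasis.repr x i‖ ^ 2 := by
  have h1 : ∀ i, T.rightSingularBasis.repr (T.adjoint (T x)) i =
      (T.singularValues i : ℂ) ^ 2 * T.rightSingularBasis.repr x i := by
    intro i
    rw [OrthonormalBasis.repr_apply_apply, OrthonormalBasis.repr_apply_apply,
      LinearMap.adjoint_inner_right, ← LinearMap.adjoint_inner_left,
      adjoint_apply_rightSingularBasis, inner_smul_left]
    simp
  have h2 : (inner ℂ x (T.adjoint (T x))) = ((‖T x‖ ^ 2 : ℝ) : ℂ) := by
    rw [LinearMap.adjoint_inner_right, inner_self_eq_norm_sq_to_K]; simp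
  rw [← T.rightSingularBasis.repr.inner_map_map, PiLp.inner_apply] at h2
  simp only [h1] at h2
  have h3 : ∀ i, inner ℂ (T.rightSingularBasis.repr x i)
      ((T.singularValues i : ℂ) ^ 2 * T.rightSingularBasis.repr x i) =
      ((T.singularValues i ^ 2 * ‖T.rightSingularBasis.repr x i‖ ^ 2 : ℝ) : ℂ) := by
    intro i
    rw [RCLike.inner_apply, mul_assoc, Complex.mul_conj, Complex.normSq_eq_norm_sq]
    push_cast; rfl
  rw [Finset.sum_congr rfl (fun i _ => h3 i), ← Complex.ofReal_sum] at h2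
  exact (Complex.ofReal_injective h2).symm

theorem norm_sq_eq_sum_rightSingularBasis (T : E →ₗ[ℂ] E) (x : E) :
    ‖x‖ ^ 2 = ∑ i, ‖T.rightSingularBasis.repr x i‖ ^ 2 := by
  rw [← T.rightSingularBasis.repr.norm_map, EuclideanSpace.norm_sq_eq]

/-- The span of the right singular vectors whose index satisfies a predicate. -/
noncomputable def singularSpan (T : E →ₗ[ℂ] E) (p : Fin (Module.finrank ℂ E) → Prop) :
    Submodule ℂ E :=
  Submodule.span ℂ (Set.range fun i : {i // p i} => T.rightSingularBasis i)

theorem finrank_singularSpan (T : E →ₗ[ℂ] E) (p : Fin (Module.finrank ℂ E) → Prop)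
    [DecidablePred p] : Module.finrank ℂ (T.singularSpan p) = Fintype.card {i // p i} := by
  apply finrank_span_eq_card
  exact T.rightSingularBasis.orthonormal.linearIndependent.comp _ Subtype.val_injective

theorem repr_eq_zero_of_mem_singularSpan (T : E →ₗ[ℂ] E)
    {p : Fin (Module.finrank ℂ E) → Prop} {x : E} (hx : x ∈ T.singularSpan p)
    {i : Fin (Module.finrank ℂ E)} (hi : ¬ p i) : T.rightSingularBasis.repr x i = 0 := by
  induction hx using Submodule.span_induction with
  | mem y hy =>
    obtain ⟨j, rfl⟩ := hy
    have : (j : Fin _) ≠ i := fun h => hi (h ▸ j.2)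
    simp [this.symm]
  | zero => simp
  | add y z _ _ hy hz => simp [hy, hz]
  | smul c y _ hy => simp [hy]

theorem exists_submodule_singularValues_mul_norm_le (T : E →ₗ[ℂ] E) {k : ℕ}
    (hk : k < Module.finrank ℂ E) :
    ∃ W : Submodule ℂ E, Module.finrank ℂ W = k + 1 ∧
      ∀ x ∈ W, T.singularValues k * ‖x‖ ≤ ‖T x‖ := by
  refine ⟨T.singularSpan (fun i => (i : ℕ) ≤ k), ?_, fun x hx => ?_⟩
  · rw [finrank_singularSpan, Fintype.card_subtype]
    have : (Finset.univ.filter fun i : Fin (Module.finrank ℂ E) => (i : ℕ) ≤ k) =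
        Finset.Iic ⟨k, hk⟩ := by ext; simp [Fin.le_def]
    rw [this, Fin.card_Iic]
  · refine le_of_sq_le_sq ?_ (norm_nonneg _)
    rw [mul_pow, norm_apply_sq_eq_sum, T.norm_sq_eq_sum_rightSingularBasis x, Finset.mul_sum]
    refine Finset.sum_le_sum fun i _ => ?_
    by_cases hi : (i : ℕ) ≤ k
    · have := T.singularValues_antitone hi
      have := T.singularValues_nonneg k
      gcongr
    · simp [T.repr_eq_zero_of_mem_singularSpan hx hi]

theorem exists_submodule_norm_le_singularValues_mul (T : E →ₗ[ℂ] E) {k : ℕ}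
    (hk : k < Module.finrank ℂ E) :
    ∃ W : Submodule ℂ E, Module.finrank ℂ W = Module.finrank ℂ E - k ∧
      ∀ x ∈ W, ‖T x‖ ≤ T.singularValues k * ‖x‖ := by
  refine ⟨T.singularSpan (fun i => k ≤ (i : ℕ)), ?_, fun x hx => ?_⟩
  · rw [finrank_singularSpan, Fintype.card_subtype]
    have : (Finset.univ.filter fun i : Fin (Module.finrank ℂ E) => k ≤ (i : ℕ)) =
        Finset.Ici ⟨k, hk⟩ := by ext; simp [Fin.le_def]
    rw [this, Fin.card_Ici]
  · refine le_of_sq_le_sq ?_ (mul_nonneg (T.singularValues_nonneg k) (norm_nonneg _))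
    rw [mul_pow, norm_apply_sq_eq_sum, T.norm_sq_eq_sum_rightSingularBasis x, Finset.mul_sum]
    refine Finset.sum_le_sum fun i _ => ?_
    by_cases hi : k ≤ (i : ℕ)
    · have := T.singularValues_antitone hi
      have := T.singularValues_nonneg i
      gcongr
    · simp [T.repr_eq_zero_of_mem_singularSpan hx hi]

theorem _root_.Submodule.exists_ne_zero_mem_inf_of_finrank_lt {W K : Submodule ℂ E}
    (h : Module.finrank ℂ E < Module.finrank ℂ W + Module.finrank ℂ K) :
    ∃ x, x ≠ 0 ∧ x ∈ W ∧ x ∈ K := by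
  have h1 := Submodule.finrank_sup_add_finrank_inf_eq W K
  have h2 := Submodule.finrank_le (W ⊔ K)
  have h3 : W ⊓ K ≠ ⊥ := by
    intro h4
    rw [h4, finrank_bot] at h1
    omega
  obtain ⟨x, hx, hx0⟩ := Submodule.exists_mem_ne_zero_of_ne_bot h3
  exact ⟨x, hx0, hx.1, hx.2⟩

/-- Courant–Fischer: by dimension, `W` meets the span of the right singular vectors of index at
least `k`, on which `T` stretches by at most the `k`-th singular value. -/
theorem le_singularValues_of_submodule (T : E →ₗ[ℂ] E) {k : ℕ} {c : ℝ} (W : Submodule ℂ E)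
    (hW : k + 1 ≤ Module.finrank ℂ W) (h : ∀ x ∈ W, c * ‖x‖ ≤ ‖T x‖) :
    c ≤ T.singularValues k := by
  have hk : k < Module.finrank ℂ E := hW.trans (Submodule.finrank_le W)
  obtain ⟨K, hK, hKT⟩ := T.exists_submodule_norm_le_singularValues_mul hk
  obtain ⟨x, hx0, hxW, hxK⟩ := Submodule.exists_ne_zero_mem_inf_of_finrank_lt (W := W) (K := K)
    (by omega)
  exact le_of_mul_le_mul_right ((h x hxW).trans (hKT x hxK)) (norm_pos_iff.2 hx0)

theorem singularValues_le_of_submodule (T : E →ₗ[ℂ] E) {k : ℕ} {c : ℝ}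
    (hk : k < Module.finrank ℂ E) (K : Submodule ℂ E)
    (hK : Module.finrank ℂ E ≤ Module.finrank ℂ K + k) (h : ∀ x ∈ K, ‖T x‖ ≤ c * ‖x‖) :
    T.singularValues k ≤ c := by
  obtain ⟨W, hW, hWT⟩ := T.exists_submodule_singularValues_mul_norm_le hk
  obtain ⟨x, hx0, hxW, hxK⟩ := Submodule.exists_ne_zero_mem_inf_of_finrank_lt (W := W) (K := K)
    (by omega)
  exact le_of_mul_le_mul_right ((hWT x hxW).trans (h x hxK)) (norm_pos_iff.2 hx0)

/-- Weyl's inequality, the source of the continuity of singular values. -/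
theorem singularValues_le_add_of_norm_sub_le (S T : E →ₗ[ℂ] E) {k : ℕ} {c : ℝ} (hc : 0 ≤ c)
    (h : ∀ x, ‖S x - T x‖ ≤ c * ‖x‖) :
    S.singularValues k ≤ T.singularValues k + c := by
  by_cases hk : k < Module.finrank ℂ E
  · obtain ⟨W, hW, hWS⟩ := S.exists_submodule_singularValues_mul_norm_le hk
    rw [← sub_le_iff_le_add]
    refine T.le_singularValues_of_submodule W hW.ge fun x hx => ?_
    have h1 := hWS x hx
    have h2 := h x
    have h3 := norm_sub_norm_le (S x) (T x)
    linarith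
  · rw [S.singularValues_of_finrank_le (not_lt.1 hk)]
    exact add_nonneg (T.singularValues_nonneg k) hc

/-- Eigenvectors of the self-adjoint `T*T` for different eigenvalues are orthogonal, so only the
`k`-th coordinate of `v` survives. This allows the given singular vector to be replaced by the basis
vector. -/
theorem exists_phase_of_simple_singularValue (T : E →ₗ[ℂ] E)
    (k : Fin (Module.finrank ℂ E))
    (hsimple : ∀ j : Fin (Module.finrank ℂ E), T.singularValues j = T.singularValues k → j = k)
    {v : E} (hv : ‖v‖ = 1)
    (hTv : T.adjoint (T v) = ((T.singularValues k : ℂ) ^ 2) • v) :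
    ∃ c : ℂ, ‖c‖ = 1 ∧ v = c • T.rightSingularBasis k := by
  have h1 : ∀ i, i ≠ k → T.rightSingularBasis.repr v i = 0 := by
    intro i hi
    have h2 : inner ℂ (T.rightSingularBasis i) (T.adjoint (T v)) =
        inner ℂ (T.adjoint (T (T.rightSingularBasis i))) v := by
      rw [LinearMap.adjoint_inner_right, LinearMap.adjoint_inner_left]
    rw [hTv, adjoint_apply_rightSingularBasis, inner_smul_left, inner_smul_right] at h2
    rw [OrthonormalBasis.repr_apply_apply]
    by_contra h3
    have h4 := mul_right_cancel₀ h3 h2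
    have h5 : T.singularValues k ^ 2 = T.singularValues i ^ 2 := by
      apply Complex.ofReal_injective
      simpa using h4
    have h6 : T.singularValues i = T.singularValues k :=
      ((sq_eq_sq₀ (T.singularValues_nonneg _) (T.singularValues_nonneg _)).1 h5).symm
    exact hi (hsimple i h6)
  have h2 : v = T.rightSingularBasis.repr v k • T.rightSingularBasis k := by
    conv_lhs => rw [← T.rightSingularBasis.sum_repr v]
    rw [Finset.sum_eq_single k]
    · intro i _ hi
      rw [h1 i hi, zero_smul]
    · simp
  refine ⟨_, ?_, h2⟩
  have h3 := congrArg norm h2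
  rw [norm_smul, T.rightSingularBasis.orthonormal.1, mul_one, hv] at h3
  exact h3.symm

theorem exists_gap_of_simple_singularValue (T : E →ₗ[ℂ] E) (k : Fin (Module.finrank ℂ E))
    (hsimple : ∀ j : Fin (Module.finrank ℂ E), T.singularValues j = T.singularValues k → j = k) :
    ∃ c : ℝ, 0 < c ∧ ∀ j : Fin (Module.finrank ℂ E), j < k →
      T.singularValues k ^ 2 + c ≤ T.singularValues j ^ 2 := by
  rcases Nat.eq_zero_or_pos (k : ℕ) with h0 | h0
  · refine ⟨1, one_pos, fun j hj => ?_⟩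
    have : (j : ℕ) < k := hj
    omega
  · have hk := k.2
    have h1 : T.singularValues k < T.singularValues (k - 1 : ℕ) := by
      refine lt_of_le_of_ne (T.singularValues_antitone (Nat.sub_le _ _)) fun h => ?_
      have h2 := congrArg Fin.val (hsimple ⟨(k : ℕ) - 1, by omega⟩ h.symm)
      simp only at h2
      omega
    refine ⟨T.singularValues (k - 1 : ℕ) ^ 2 - T.singularValues k ^ 2,
      sub_pos.2 (pow_lt_pow_left₀ h1 (T.singularValues_nonneg _) two_ne_zero), fun j hj => ?_⟩
    have hj' : (j : ℕ) ≤ k - 1 := Nat.le_sub_one_of_lt hj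
    have h2 := T.singularValues_antitone hj'
    have h3 := pow_le_pow_left₀ (T.singularValues_nonneg _) h2 2
    linarith

theorem norm_sub_repr_smul_sq (T : E →ₗ[ℂ] E) (k : Fin (Module.finrank ℂ E)) (x : E) :
    ‖x - T.rightSingularBasis.repr x k • T.rightSingularBasis k‖ ^ 2 =
      ∑ i ∈ Finset.univ.erase k, ‖T.rightSingularBasis.repr x i‖ ^ 2 := by
  rw [T.norm_sq_eq_sum_rightSingularBasis, ← Finset.add_sum_erase _ _ (Finset.mem_univ k)]
  have h1 : ‖T.rightSingularBasis.repr
      (x - T.rightSingularBasis.repr x k • T.rightSingularBasis k) k‖ ^ 2 = 0 := by simp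
  rw [h1, zero_add]
  refine Finset.sum_congr rfl fun i hi => ?_
  have : k ≠ i := (Finset.ne_of_mem_erase hi).symm
  simp [this]

/-- On the span of the first singular vectors, the component orthogonal to the `k`-th one gains an
extra `c`; this pays for the cross terms of a perturbation. -/
theorem gap_le_norm_apply_sq (T : E →ₗ[ℂ] E) (k : Fin (Module.finrank ℂ E)) {c : ℝ}
    (hc : ∀ j : Fin (Module.finrank ℂ E), j < k →
      T.singularValues k ^ 2 + c ≤ T.singularValues j ^ 2)
    {x : E} (hx : x ∈ T.singularSpan (fun i => i ≤ k)) :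
    T.singularValues k ^ 2 * ‖x‖ ^ 2 +
      c * ‖x - T.rightSingularBasis.repr x k • T.rightSingularBasis k‖ ^ 2 ≤ ‖T x‖ ^ 2 := by
  rw [norm_sub_repr_smul_sq, T.norm_sq_eq_sum_rightSingularBasis, T.norm_apply_sq_eq_sum,
    ← Finset.add_sum_erase _ _ (Finset.mem_univ k),
    ← Finset.add_sum_erase (a := k) _ (fun i : Fin (Module.finrank ℂ E) =>
      T.singularValues i ^ 2 * ‖T.rightSingularBasis.repr x i‖ ^ 2) (Finset.mem_univ k),
    mul_add, add_assoc, add_le_add_iff_left, Finset.mul_sum, Finset.mul_sum,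
    ← Finset.sum_add_distrib]
  refine Finset.sum_le_sum fun i hi => ?_
  by_cases hik : i ≤ k
  · rw [← add_mul]
    gcongr
    exact hc i (lt_of_le_of_ne hik (Finset.ne_of_mem_erase hi))
  · simp [T.repr_eq_zero_of_mem_singularSpan hx hik]

end LinearMap

/-! ### First-order growth of a simple singular value. -/

theorem re_inner_add_lower_bound {E : Type*} [NormedAddCommGroup E] [InnerProductSpace ℂ E]
    (S D : E →L[ℂ] E) (e y : E) (he : ‖e‖ = 1) (a : ℂ) :
    ‖a‖ ^ 2 * (inner ℂ (S e) (D e)).re - ‖S‖ * ‖D‖ * (2 * ‖a‖ * ‖y‖ + ‖y‖ ^ 2) ≤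
      (inner ℂ (S (a • e + y)) (D (a • e + y))).re := by
  have key : ∀ u v : E, |(inner ℂ (S u) (D v)).re| ≤ ‖S‖ * ‖D‖ * (‖u‖ * ‖v‖) := fun u v =>
    calc |(inner ℂ (S u) (D v)).re| ≤ ‖inner ℂ (S u) (D v)‖ := Complex.abs_re_le_norm _
      _ ≤ ‖S u‖ * ‖D v‖ := norm_inner_le_norm _ _
      _ ≤ (‖S‖ * ‖u‖) * (‖D‖ * ‖v‖) := by
        gcongr
        · exact S.le_opNorm u
        · exact D.le_opNorm v
      _ = _ := by ring
  have h1 := (abs_le.1 (key (a • e) y)).1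
  have h2 := (abs_le.1 (key y (a • e))).1
  have h3 := (abs_le.1 (key y y)).1
  rw [norm_smul, he, mul_one] at h1 h2
  have h4 : (inner ℂ (S (a • e)) (D (a • e))).re = ‖a‖ ^ 2 * (inner ℂ (S e) (D e)).re := by
    rw [map_smul, map_smul, inner_smul_left, inner_smul_right, ← mul_assoc, mul_comm _ a,
      Complex.mul_conj, Complex.normSq_eq_norm_sq, Complex.re_ofReal_mul]
  rw [map_add S, map_add D, inner_add_left, inner_add_right, inner_add_right]
  simp only [Complex.add_re]
  rw [h4]
  nlinarith

theorem norm_sq_add_le_of_near {E : Type*} [NormedAddCommGroup E] [InnerProductSpace ℂ E]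
    (S D G : E →L[ℂ] E) {t η : ℝ} (x : E) (h : ‖G - S - t • D‖ ≤ η * t) :
    ‖S x‖ ^ 2 + 2 * t * (inner ℂ (S x) (D x)).re - 2 * ‖S‖ * (η * t) * ‖x‖ ^ 2 ≤ ‖G x‖ ^ 2 := by
  have h1 : G x = S x + ((t • D) x + (G - S - t • D) x) := by
    simp
  have h2 : ‖(G - S - t • D) x‖ ≤ η * t * ‖x‖ :=
    ((G - S - t • D).le_opNorm x).trans (by gcongr)
  have h3 : |(inner ℂ (S x) ((G - S - t • D) x)).re| ≤ ‖S‖ * ‖x‖ * (η * t * ‖x‖) :=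
    calc _ ≤ ‖inner ℂ (S x) ((G - S - t • D) x)‖ := Complex.abs_re_le_norm _
      _ ≤ ‖S x‖ * ‖(G - S - t • D) x‖ := norm_inner_le_norm _ _
      _ ≤ _ := by
        gcongr
        exact S.le_opNorm x
  have h4 : (inner ℂ (S x) ((t • D) x)).re = t * (inner ℂ (S x) (D x)).re := by
    rw [_root_.smul_apply, inner_smul_right_eq_smul]
    simp
  rw [h1, @norm_add_sq ℂ, inner_add_right, map_add]
  simp only [RCLike.re_to_complex]
  rw [h4]
  have h5 := (abs_le.1 h3).1
  nlinarith [sq_nonneg ‖(t • D) x + (G - S - t • D) x‖]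

/-- Here `α` and `b` are the sizes of the components of the test vector along and orthogonal to the
singular vector. The first-order gain `2tβα²` and the gap `cb²` absorb all errors; the cross term
`4tKαb` is split by the arithmetic-geometric mean inequality. -/
theorem quadratic_perturbation_bound {s c β K η L t α b : ℝ} (hc : 0 < c) (hβ : 0 < β)
    (ht : 0 < t) (hη : 2 * L * η ≤ β / 4)
    (ht1 : 16 * t * K ^ 2 ≤ c * β) (ht2 : t * (2 * K + β / 4) ≤ c / 4) :
    (s ^ 2 + min (t * β) (c / 4)) * (α ^ 2 + b ^ 2) ≤
      s ^ 2 * (α ^ 2 + b ^ 2) + c * b ^ 2 +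
        2 * t * (α ^ 2 * β - K * (2 * α * b + b ^ 2)) - 2 * L * (η * t) * (α ^ 2 + b ^ 2) := by
  have h1 : min (t * β) (c / 4) * α ^ 2 ≤ t * β * α ^ 2 := by
    gcongr; exact min_le_left _ _
  have h2 : min (t * β) (c / 4) * b ^ 2 ≤ c / 4 * b ^ 2 := by
    gcongr; exact min_le_right _ _
  have h3 : 2 * L * (η * t) * (α ^ 2 + b ^ 2) ≤ t * (β / 4) * (α ^ 2 + b ^ 2) := by
    have := mul_le_mul_of_nonneg_left hη ht.le
    have h : 2 * L * (η * t) ≤ t * (β / 4) := by linarith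
    gcongr
  have h4 : t * (2 * K + β / 4) * b ^ 2 ≤ c / 4 * b ^ 2 := by gcongr
  have h5 : 4 * t * K * α * b ≤ c / 2 * b ^ 2 + t * β / 2 * α ^ 2 := by
    have h6 : 0 ≤ (c * b - 4 * t * K * α) ^ 2 := sq_nonneg _
    have h7 : 16 * t * K ^ 2 * (t * α ^ 2) ≤ c * β * (t * α ^ 2) := by gcongr
    have h8 : c * (4 * t * K * α * b) ≤ c * (c / 2 * b ^ 2 + t * β / 2 * α ^ 2) := by nlinarith
    exact le_of_mul_le_mul_left h8 hc
  nlinarith [mul_nonneg (mul_nonneg ht.le hβ.le) (sq_nonneg α)]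

open Filter Topology in
-- The span of the first `k + 1` right singular vectors of `F 0` serves as test space for `F t`. For
-- small `t > 0`, the squared stretch of every vector in it exceeds the old value by at least `min
-- (tβ) (c/4)`, so no differentiability of singular values is needed.
theorem exists_lt_singularValues_of_hasDerivAt {E : Type*} [NormedAddCommGroup E]
    [InnerProductSpace ℂ E] [FiniteDimensional ℂ E] {F : ℝ → E →L[ℂ] E} {D : E →L[ℂ] E}
    (hF : HasDerivAt F D 0) (k : Fin (Module.finrank ℂ E))
    (hsimple : ∀ j : Fin (Module.finrank ℂ E), (F 0 : E →ₗ[ℂ] E).singularValues j =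
      (F 0 : E →ₗ[ℂ] E).singularValues k → j = k)
    {v : E} (hv : ‖v‖ = 1)
    (hTv : (F 0 : E →ₗ[ℂ] E).adjoint (F 0 v) =
      (((F 0 : E →ₗ[ℂ] E).singularValues k : ℂ) ^ 2) • v)
    (hpos : 0 < (inner ℂ (F 0 v) (D v)).re) :
    ∃ t, (F 0 : E →ₗ[ℂ] E).singularValues k < (F t : E →ₗ[ℂ] E).singularValues k := by
  set T : E →ₗ[ℂ] E := (F 0 : E →ₗ[ℂ] E) with hT
  obtain ⟨c, hc, hgap⟩ := T.exists_gap_of_simple_singularValue k hsimple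
  obtain ⟨u, hu, rfl⟩ := T.exists_phase_of_simple_singularValue k hsimple hv hTv
  set e := T.rightSingularBasis k with he
  have he1 : ‖e‖ = 1 := T.rightSingularBasis.orthonormal.1 k
  set β := (inner ℂ (F 0 e) (D e)).re with hβ
  have hβpos : 0 < β := by
    have h4 : (inner ℂ (F 0 (u • e)) (D (u • e))).re = ‖u‖ ^ 2 * β := by
      rw [map_smul, map_smul, inner_smul_left, inner_smul_right, ← mul_assoc, mul_comm _ u,
        Complex.mul_conj, Complex.normSq_eq_norm_sq, Complex.re_ofReal_mul]
    rwa [h4, hu, one_pow, one_mul] at hpos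
  set L := ‖F 0‖
  set K := ‖F 0‖ * ‖D‖
  have hL : 0 ≤ L := norm_nonneg _
  -- Chosen so that `2Lη ≤ β/4`: the error of the linearization then costs at most an eighth of the
  -- gain `2tβ`.
  set η := β / (8 * (L + 1))
  have hηpos : 0 < η := by positivity
  have hη : 2 * L * η ≤ β / 4 := by
    have : η * (8 * (L + 1)) = β := div_mul_cancel₀ _ (by positivity)
    nlinarith
  have e1 : ∀ᶠ t in 𝓝[>] (0 : ℝ), ‖F t - F 0 - t • D‖ ≤ η * t := by
    have h := (hasDerivAt_iff_isLittleO.1 hF).def hηpos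
    filter_upwards [h.filter_mono nhdsWithin_le_nhds, self_mem_nhdsWithin] with t ht ht0
    have : (0 : ℝ) < t := ht0
    simpa [abs_of_pos this] using ht
  have e2 : ∀ᶠ t in 𝓝[>] (0 : ℝ), 16 * t * K ^ 2 < c * β := by
    have : Tendsto (fun t : ℝ => 16 * t * K ^ 2) (𝓝 0) (𝓝 (16 * 0 * K ^ 2)) :=
      Continuous.tendsto (by fun_prop) 0
    exact (this.eventually (gt_mem_nhds (by simpa using mul_pos hc hβpos))).filter_mono
      nhdsWithin_le_nhds
  have e3 : ∀ᶠ t in 𝓝[>] (0 : ℝ), t * (2 * K + β / 4) < c / 4 := by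
    have : Tendsto (fun t : ℝ => t * (2 * K + β / 4)) (𝓝 0) (𝓝 (0 * (2 * K + β / 4))) :=
      Continuous.tendsto (by fun_prop) 0
    exact (this.eventually (gt_mem_nhds (by rw [zero_mul]; positivity))).filter_mono
      nhdsWithin_le_nhds
  obtain ⟨t, ht0, ht1, ht2, ht3⟩ := (eventually_mem_nhdsWithin.and (e1.and (e2.and e3))).exists
  replace ht0 : 0 < t := ht0
  refine ⟨t, ?_⟩
  set s := T.singularValues k
  have hs : 0 ≤ s := T.singularValues_nonneg _
  have hε : 0 < min (t * β) (c / 4) := lt_min (by positivity) (by positivity)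
  have hlt : s < √(s ^ 2 + min (t * β) (c / 4)) := Real.lt_sqrt_of_sq_lt (by linarith)
  refine hlt.trans_le ?_
  refine LinearMap.le_singularValues_of_submodule _ (T.singularSpan (fun i => i ≤ k)) ?_ ?_
  · rw [T.finrank_singularSpan, Fintype.card_subtype]
    have : (Finset.univ.filter fun i : Fin (Module.finrank ℂ E) => i ≤ k) =
        Finset.Iic k := by ext; simp
    rw [this, Fin.card_Iic]
  · intro x hx
    refine le_of_sq_le_sq ?_ (norm_nonneg _)
    rw [mul_pow, Real.sq_sqrt (by positivity)]
    set a := T.rightSingularBasis.repr x k with ha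
    have h1 := T.gap_le_norm_apply_sq k hgap hx
    have h2 := T.norm_sub_repr_smul_sq k x
    have h3 := T.norm_sq_eq_sum_rightSingularBasis x
    rw [← Finset.add_sum_erase _ _ (Finset.mem_univ k), ← h2] at h3
    rw [← ha, ← he] at h1 h3
    set y := x - a • e with hy
    have hx' : x = a • e + y := by rw [hy]; abel
    have h4 := re_inner_add_lower_bound (F 0) D e y he1 a
    rw [← hx'] at h4
    have h5 := norm_sq_add_le_of_near (F 0) D (F t) x ht1
    have h6 := quadratic_perturbation_bound (s := s) (α := ‖a‖) (b := ‖y‖) hc hβpos ht0 hη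
      ht2.le ht3.le
    rw [← h3] at h6
    change _ ≤ ‖F t x‖ ^ 2
    refine le_trans ?_ h5
    refine h6.trans ?_
    change _ ≤ ‖F 0 x‖ ^ 2 at h1
    have h7 := mul_le_mul_of_nonneg_left h4 (by positivity : 0 ≤ 2 * t)
    linarith

/-! ### Block structure of `𝒬`: Taylor expansion and increasing paths. -/

namespace MatPolyDist

variable {n m r : ℕ}

/-- The strictly upper triangular part of `C(μ,Γ)`. -/
def nilPart (Γ : Params r) : Matrix (Fin r) (Fin r) ℂ :=
  Matrix.of fun i k => gam Γ k i

theorem nilPart_apply_of_le (Γ : Params r) {i k : Fin r} (h : k ≤ i) : nilPart Γ i k = 0 := by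
  simp [nilPart, gam, not_lt.2 h]

theorem Cmat_eq_add_nilPart (μ : ℂ) (Γ : Params r) :
    Cmat (fun _ => μ) Γ = algebraMap ℂ _ μ + nilPart Γ := by
  ext i k
  by_cases h : i = k
  · subst h
    simp [Cmat, nilPart_apply_of_le, Matrix.algebraMap_matrix_apply]
  · simp [Cmat, h, nilPart, Matrix.algebraMap_matrix_apply]

theorem nilPart_pow_apply_eq_zero (Γ : Params r) (k : ℕ) {i j : Fin r}
    (h : (j : ℕ) < i + k) : (nilPart Γ ^ k) i j = 0 := by
  induction k generalizing i with
  | zero =>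
    rw [pow_zero, Matrix.one_apply_ne]
    rintro rfl
    omega
  | succ k ih =>
    rw [pow_succ', Matrix.mul_apply]
    refine Finset.sum_eq_zero fun q _ => ?_
    by_cases hq : q ≤ i
    · rw [nilPart_apply_of_le Γ hq, zero_mul]
    · rw [ih, mul_zero]
      have : (i : ℕ) < q := not_le.1 hq
      omega

theorem pow_apply_eq_sum_paths {R : Type*} [CommRing R] (N : Matrix (Fin r) (Fin r) R) (k : ℕ)
    (l i : Fin r) :
    (N ^ k) l i = ∑ s : Fin (k + 1) → Fin r,
      if s 0 = l ∧ s (Fin.last k) = i then ∏ t : Fin k, N (s t.castSucc) (s t.succ) else 0 := by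
  induction k generalizing l with
  | zero =>
    rw [pow_zero, Matrix.one_apply, ← (Equiv.funUnique (Fin 1) (Fin r)).symm.sum_comp]
    rw [Finset.sum_eq_single l]
    · simp
    · intro q _ hq
      simp [hq]
    · simp
  | succ k ih =>
    rw [pow_succ', Matrix.mul_apply]
    symm
    rw [← (Fin.consEquiv (fun _ : Fin (k + 2) => Fin r)).sum_comp,
      Fintype.sum_prod_type, Finset.sum_eq_single l]
    · simp only [ih, Finset.mul_sum]
      rw [Finset.sum_comm]
      refine Finset.sum_congr rfl fun s _ => ?_
      rw [Finset.sum_eq_single (s 0)]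
      · simp [Fin.consEquiv, ← Fin.succ_last, Fin.prod_univ_succ]
      · intro q _ hq
        simp [hq.symm]
      · simp
    · intro q _ hq
      simp [Fin.consEquiv, hq]
    · simp

/-- In the sum over all paths, one with a non-increasing step contains a zero factor. -/
theorem nilPart_pow_apply (Γ : Params r) (k : ℕ) (l i : Fin r) :
    (nilPart Γ ^ k) l i =
      ∑ s ∈ incSeqs l i k, ∏ t : Fin k, gam Γ (s t.succ) (s t.castSucc) := by
  classical
  rw [pow_apply_eq_sum_paths, incSeqs, Finset.sum_filter]
  refine Finset.sum_congr rfl fun s _ => ?_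
  by_cases hs : StrictMono s
  · simp [hs, nilPart]
  · simp only [hs, false_and, if_false]
    split_ifs
    · rw [Fin.strictMono_iff_lt_succ] at hs
      push Not at hs
      obtain ⟨t, ht⟩ := hs
      exact Finset.prod_eq_zero (Finset.mem_univ t) (nilPart_apply_of_le Γ ht)
    · rfl

/-- The evaluation of a matrix polynomial `P` at a square matrix `C`, that is
`∑_j (C ^ j)ᵀ ⊗ A_j` for `P(λ) = ∑_j λ ^ j A_j`. -/
noncomputable def blockEval (C : Matrix (Fin r) (Fin r) ℂ) (P : Matrix (Fin n) (Fin n) ℂ[X]) :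
    Matrix (Fin r × Fin n) (Fin r × Fin n) ℂ :=
  Matrix.of fun x y => aeval C (P x.2 y.2) y.1 x.1

/-- The transposition reverses products, which is harmless because polynomials in a single matrix
commute. -/
theorem blockEval_mul (C : Matrix (Fin r) (Fin r) ℂ) (P P' : Matrix (Fin n) (Fin n) ℂ[X]) :
    blockEval C (P * P') = blockEval C P * blockEval C P' := by
  ext ⟨i, a⟩ ⟨l, c⟩
  simp only [blockEval, Matrix.of_apply, Matrix.mul_apply, map_sum, Fintype.sum_prod_type]
  rw [Finset.sum_comm, Matrix.sum_apply]
  refine Finset.sum_congr rfl fun b _ => ?_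
  rw [mul_comm, map_mul, Matrix.mul_apply]
  exact Finset.sum_congr rfl fun q _ => mul_comm _ _

theorem blockEval_add (C : Matrix (Fin r) (Fin r) ℂ) (P P' : Matrix (Fin n) (Fin n) ℂ[X]) :
    blockEval C (P + P') = blockEval C P + blockEval C P' := by
  ext ⟨i, a⟩ ⟨l, c⟩
  simp [blockEval]

theorem matPoly_apply (A : Fin (m + 1) → Matrix (Fin n) (Fin n) ℂ) (a b : Fin n) :
    matPoly A a b = ∑ j : Fin (m + 1), X ^ (j : ℕ) * C (A j a b) := by
  simp [matPoly, Matrix.sum_apply]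

theorem Qmat_eq_blockEval (A : Fin (m + 1) → Matrix (Fin n) (Fin n) ℂ) (μ : Fin r → ℂ)
    (Γ : Params r) : Qmat A μ Γ = blockEval (Cmat μ Γ) (matPoly A) := by
  ext ⟨i, a⟩ ⟨l, b⟩
  simp only [Qmat, blockEval, Matrix.sum_apply, Matrix.of_apply, matPoly_apply, map_sum,
    Matrix.kroneckerMap_apply, Matrix.transpose_apply]
  refine Finset.sum_congr rfl fun j _ => ?_
  rw [mul_comm (X ^ _ : ℂ[X]), map_mul, aeval_C, map_pow, aeval_X, Algebra.algebraMap_eq_smul_one,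
    smul_mul_assoc, one_mul, Matrix.smul_apply, smul_eq_mul, mul_comm]

/-- The expansion stops at `r` because the `r`-th power of the strictly triangular part vanishes. -/
theorem aeval_nilPart_apply (Γ : Params r) (q : ℂ[X]) (l i : Fin r) :
    aeval (nilPart Γ) q l i = ∑ k ∈ Finset.range r, q.coeff k * (nilPart Γ ^ k) l i := by
  rw [aeval_eq_sum_range' (lt_of_lt_of_le (Nat.lt_succ_self _) (le_max_right r _)),
    Matrix.sum_apply]
  symm
  refine (Finset.sum_subset (Finset.range_subset_range.2 (le_max_left _ _)) ?_).trans
    (Finset.sum_congr rfl fun k _ => by rw [Matrix.smul_apply, smul_eq_mul])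
  intro k _ hk
  rw [nilPart_pow_apply_eq_zero, mul_zero]
  have := i.2
  simp only [Finset.mem_range, not_lt] at hk
  omega

theorem aeval_Cmat (μ : ℂ) (Γ : Params r) (p : ℂ[X]) :
    aeval (Cmat (fun _ => μ) Γ) p = aeval (nilPart Γ) (taylor μ p) := by
  rw [taylor_apply, aeval_comp, Cmat_eq_add_nilPart]
  simp [add_comm]

theorem derivAt_apply (P : Matrix (Fin n) (Fin n) ℂ[X]) (k : ℕ) (z : ℂ) (a b : Fin n) :
    derivAt P k z a b = k.factorial * (taylor z (P a b)).coeff k := by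
  have := congrFun (factorial_smul_hasseDeriv (R := ℂ) k) (P a b)
  rw [derivAt, Matrix.map_apply, ← this, taylor_coeff]
  simp

theorem block_Qmat_apply (A : Fin (m + 1) → Matrix (Fin n) (Fin n) ℂ) (μ : ℂ) (Γ : Params r)
    (i l : Fin r) (a b : Fin n) :
    block (Qmat A (fun _ => μ) Γ) i l a b = ∑ k ∈ Finset.range r,
      (nilPart Γ ^ k) l i * ((k.factorial : ℂ)⁻¹ * derivAt (matPoly A) k μ a b) := by
  rw [block, Matrix.of_apply, Qmat_eq_blockEval, blockEval, Matrix.of_apply, aeval_Cmat,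
    aeval_nilPart_apply]
  refine Finset.sum_congr rfl fun k _ => ?_
  have : (k.factorial : ℂ) ≠ 0 := Nat.cast_ne_zero.2 k.factorial_ne_zero
  rw [derivAt_apply, inv_mul_cancel_left₀ this, mul_comm]

theorem block_Qmat (A : Fin (m + 1) → Matrix (Fin n) (Fin n) ℂ) (μ : ℂ) (Γ : Params r)
    (i l : Fin r) :
    block (Qmat A (fun _ => μ) Γ) i l =
      if l < i then offDiagBlock (matPoly A) μ Γ i l
      else if i = l then derivAt (matPoly A) 0 μ
      else 0 := by
  ext a b
  rw [block_Qmat_apply]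
  split_ifs with h1 h2
  · rw [offDiagBlock, Matrix.sum_apply]
    refine Finset.sum_congr rfl fun k _ => ?_
    rw [← Finset.sum_smul, ← nilPart_pow_apply]
    simp
  · subst h2
    rw [Finset.sum_eq_single 0]
    · simp
    · intro k _ hk
      rw [nilPart_pow_apply_eq_zero Γ k (by omega), zero_mul]
    · intro h
      have := i.2
      simp at h
      omega
  · rw [Matrix.zero_apply]
    refine Finset.sum_eq_zero fun k _ => ?_
    have h3 : i < l := lt_of_le_of_ne (not_lt.1 h1) h2
    have h4 : (i : ℕ) < l := h3
    rw [nilPart_pow_apply_eq_zero Γ k (by omega), zero_mul]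

end MatPolyDist

/-! ### Diagonal reduction over a principal ideal domain and distribution of prime powers. -/

/-- A diagonal reduction of a square matrix over a principal ideal domain. -/
theorem Matrix.exists_eq_mul_diagonal_mul {R : Type*} [CommRing R] [IsDomain R]
    [IsPrincipalIdealRing R] {n : ℕ} (P : Matrix (Fin n) (Fin n) R) :
    ∃ (E G : Matrix (Fin n) (Fin n) R) (d : Fin n → R),
      P = E * diagonal d * G ∧ Associated P.det (∏ i, d i) := by
  -- Smith normal form of the column space: the basis `bM` gives the columns of `E`, and `G` holds
  -- the coordinates of the columns of `P` in `bN`, with zero rows outside the range of `f`.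
  obtain ⟨k, bM, bN, f, a, hsnf⟩ :=
    (LinearMap.range P.mulVecLin).smithNormalForm (Pi.basisFun R (Fin n))
  let c : Fin k → Fin n → R := fun t j => bN.repr (P.mulVecLin.rangeRestrict (Pi.single j 1)) t
  let E : Matrix (Fin n) (Fin n) R := Matrix.of fun x i => bM i x
  let d : Fin n → R := Function.extend f a 0
  let G : Matrix (Fin n) (Fin n) R := Matrix.of fun i j => Function.extend f (fun t => c t j) 0 i
  have hEG : P = E * diagonal d * G := by
    ext x j
    have h1 := congrArg (fun v => v x) (congrArg Subtype.val
      (bN.sum_repr (P.mulVecLin.rangeRestrict (Pi.single j 1))))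
    have h2 : P x j = ∑ t, E x (f t) * a t * c t j := by
      simp only [AddSubmonoidClass.coe_finsetSum, SetLike.val_smul, hsnf, Finset.sum_apply,
        Pi.smul_apply, smul_eq_mul, LinearMap.codRestrict_apply, LinearMap.rangeRestrict,
        mulVecLin_apply, mulVec_single_one, Matrix.col_apply] at h1
      rw [← h1]
      refine Finset.sum_congr rfl fun t _ => ?_
      simp only [E, c, LinearMap.rangeRestrict, Matrix.of_apply]
      ring
    rw [h2, Matrix.mul_apply]
    simp only [Matrix.mul_diagonal]
    refine Fintype.sum_of_injective f f.injective _ _ (fun i hi => ?_) (fun t => ?_)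
    · simp only [d]
      rw [Function.extend_apply' _ _ _ (by simpa using hi)]
      simp
    · simp [d, G, f.injective.extend_apply]
  refine ⟨E, G, d, hEG, ?_⟩
  have hE : IsUnit E.det := by
    have h3 : E = (Pi.basisFun R (Fin n)).toMatrix bM := by
      ext x i
      simp [E, Module.Basis.toMatrix_apply]
    rw [h3, ← Matrix.isUnit_iff_isUnit_det]
    let := (Pi.basisFun R (Fin n)).invertibleToMatrix bM
    exact isUnit_of_invertible _
  have hdet : P.det = E.det * (∏ i, d i) * G.det := by
    conv_lhs => rw [hEG]
    rw [det_mul, det_mul, det_diagonal]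
  -- If `f` is onto, `G` is surjective, hence invertible. Otherwise some diagonal entry is zero and
  -- both sides of the association vanish, so invertibility of `G` is not needed.
  by_cases hf : Function.Surjective f
  · have hG : IsUnit G.det := by
      rw [← Matrix.isUnit_iff_isUnit_det, ← Matrix.mulVec_surjective_iff_isUnit]
      intro y
      obtain ⟨x, hx⟩ := (bN.equivFun.symm (fun t => y (f t))).2
      refine ⟨x, funext fun i => ?_⟩
      obtain ⟨t, rfl⟩ := hf i
      have h4 : P.mulVecLin.rangeRestrict x = bN.equivFun.symm (fun t => y (f t)) :=
        Subtype.ext hx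
      have h5 : bN.repr (P.mulVecLin.rangeRestrict x) t = y (f t) := by
        rw [h4, ← Module.Basis.equivFun_apply, LinearEquiv.apply_symm_apply]
      rw [← h5]
      conv_rhs => rw [pi_eq_sum_univ' x]
      simp [G, Matrix.mulVec, dotProduct, f.injective.extend_apply, c, map_sum, map_smul,
        mul_comm]
    rw [hdet, mul_assoc]
    exact (associated_unit_mul_left _ _ hE).trans (associated_mul_unit_left _ _ hG)
  · obtain ⟨i, hi⟩ := not_forall.1 hf
    have h6 : ∏ i, d i = 0 := Finset.prod_eq_zero (Finset.mem_univ i)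
      (Function.extend_apply' _ _ _ hi)
    rw [hdet, h6]
    simp

/-- One factor `p` at a time is removed from some `d i` and cancelled. Zero entries are allowed,
which covers a vanishing determinant. -/
theorem Prime.exists_sum_eq_and_pow_dvd_of_pow_dvd_prod {R ι : Type*} [CommRing R] [IsDomain R]
    [Fintype ι] {p : R} (hp : Prime p) (k : ℕ) (d : ι → R) (h : p ^ k ∣ ∏ i, d i) :
    ∃ κ : ι → ℕ, ∑ i, κ i = k ∧ ∀ i, p ^ κ i ∣ d i := by
  classical
  induction k generalizing d with
  | zero => exact ⟨0, by simp⟩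
  | succ k ih =>
    obtain ⟨i, -, q, hq⟩ := (hp.dvd_finsetProd_iff d).1 ((dvd_pow_self p k.succ_ne_zero).trans h)
    have h1 : ∏ j, d j = p * ∏ j, Function.update d i q j := by
      rw [Finset.prod_update_of_mem (Finset.mem_univ i), ← mul_assoc, ← hq,
        ← Finset.mul_prod_erase _ _ (Finset.mem_univ i), Finset.sdiff_singleton_eq_erase]
    rw [h1, pow_succ', mul_dvd_mul_iff_left hp.ne_zero] at h
    obtain ⟨κ, hκ, hdvd⟩ := ih _ h
    refine ⟨Function.update κ i (κ i + 1), ?_, fun j => ?_⟩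
    · rw [Finset.sum_update_of_mem (Finset.mem_univ i), ← hκ,
        ← Finset.add_sum_erase _ κ (Finset.mem_univ i), Finset.sdiff_singleton_eq_erase]
      ring
    · by_cases hj : j = i
      · subst hj
        have := hdvd j
        rw [Function.update_self] at this ⊢
        rw [pow_succ', hq]
        exact mul_dvd_mul_left p this
      · have := hdvd j
        rwa [Function.update_of_ne hj] at this ⊢

/-! ### The lower bound: rank drop of the perturbed block matrix. -/

namespace MatPolyDist

variable {n m r : ℕ}

/-- `(C - μ)^κ` is the `κ`-th power of a strictly upper triangular matrix, so its last `κ` rows are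
zero. -/
theorem aeval_Cmat_apply_eq_zero (μ : ℂ) (Γ : Params r) {p : ℂ[X]} {κ : ℕ}
    (hp : (X - C μ) ^ κ ∣ p) {l : Fin r} (hl : r ≤ l + κ) (i : Fin r) :
    aeval (Cmat (fun _ => μ) Γ) p l i = 0 := by
  obtain ⟨q, rfl⟩ := hp
  have h1 : aeval (Cmat (fun _ => μ) Γ) (X - C μ) = nilPart Γ := by
    rw [Cmat_eq_add_nilPart]; simp
  rw [map_mul, map_pow, h1, Matrix.mul_apply]
  refine Finset.sum_eq_zero fun s _ => ?_
  rw [nilPart_pow_apply_eq_zero Γ κ (by omega), zero_mul]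

theorem rank_blockEval_add_le (μ : ℂ) (Γ : Params r) (P : Matrix (Fin n) (Fin n) ℂ[X])
    (hP : (X - C μ) ^ r ∣ P.det) :
    (blockEval (Cmat (fun _ => μ) Γ) P).rank + r ≤ r * n := by
  classical
  set K := Cmat (fun _ => μ) Γ
  obtain ⟨E, G, d, hEG, hd⟩ := P.exists_eq_mul_diagonal_mul
  obtain ⟨κ, hκ, hdvd⟩ := (prime_X_sub_C μ).exists_sum_eq_and_pow_dvd_of_pow_dvd_prod r d
    (hP.trans hd.dvd)
  have hκr : ∀ a, κ a ≤ r := fun a => hκ ▸ Finset.single_le_sum (fun _ _ => Nat.zero_le _)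
    (Finset.mem_univ a)
  -- Indicator of the columns that may survive; exactly `∑ κ_b = r` columns are deleted, the count
  -- in each block column using `κ_b ≤ r`.
  let w : Fin r × Fin n → ℂ := fun x => if r ≤ x.1 + κ x.2 then 0 else 1
  have h1 : blockEval K (diagonal d) = blockEval K (diagonal d) * diagonal w := by
    ext ⟨i, a⟩ ⟨l, b⟩
    rw [Matrix.mul_diagonal]
    by_cases hl : r ≤ l + κ b
    · simp only [w, hl, if_true, mul_zero, blockEval, Matrix.of_apply]
      by_cases hab : a = b
      · subst hab
        rw [diagonal_apply_eq]
        exact aeval_Cmat_apply_eq_zero μ Γ (hdvd a) hl i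
      · rw [diagonal_apply_ne _ hab]; simp
    · simp [w, hl]
  have h2 : (blockEval K P).rank ≤ (diagonal w).rank := by
    rw [hEG, blockEval_mul, blockEval_mul, h1]
    refine (rank_mul_le_left _ _).trans ((rank_mul_le_right _ _).trans (rank_mul_le_right _ _))
  rw [rank_diagonal, Fintype.card_subtype] at h2
  have h3 := Finset.card_filter_add_card_filter_not (s := (Finset.univ : Finset (Fin r × Fin n)))
    (fun x => w x ≠ 0)
  have h4 : (Finset.univ.filter fun x : Fin r × Fin n => ¬ w x ≠ 0).card = r := by
    have : ∀ b : Fin n, (Finset.univ.filter fun l : Fin r => r ≤ l + κ b).card = κ b := by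
      intro b
      have h5 := Fin.card_filter_val_lt (n := r) (m := r - κ b)
      have h6 := Finset.card_filter_add_card_filter_not (s := (Finset.univ : Finset (Fin r)))
        (fun l : Fin r => (l : ℕ) < r - κ b)
      have h7 : (Finset.univ.filter fun l : Fin r => r ≤ l + κ b) =
          Finset.univ.filter fun l : Fin r => ¬ (l : ℕ) < r - κ b := by
        ext l
        simp
      rw [h7]
      have := hκr b
      simp only [Finset.card_univ, Fintype.card_fin] at h6
      omega
    calc (Finset.univ.filter fun x : Fin r × Fin n => ¬ w x ≠ 0).card
        = ∑ x : Fin r × Fin n, if r ≤ x.1 + κ x.2 then 1 else 0 := by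
          rw [Finset.card_filter]
          refine Finset.sum_congr rfl fun x _ => ?_
          by_cases h : r ≤ x.1 + κ x.2 <;> simp [w, h]
      _ = ∑ b, κ b := by
          rw [Fintype.sum_prod_type_right]
          refine Finset.sum_congr rfl fun b _ => ?_
          rw [← Finset.card_filter, this]
      _ = r := hκ
  simp only [Finset.card_univ, Fintype.card_prod, Fintype.card_fin] at h3
  omega

theorem finrank_ker_mulVecLin_add_rank {ι : Type*} [Fintype ι] [DecidableEq ι]
    (M : Matrix ι ι ℂ) :
    M.rank + Module.finrank ℂ (LinearMap.ker M.mulVecLin) = Fintype.card ι := by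
  have := M.mulVecLin.finrank_range_add_finrank_ker
  rwa [Module.finrank_fintype_fun_eq_card] at this

theorem singVal_le_of_submodule {ι : Type*} [Fintype ι] [DecidableEq ι] (M : Matrix ι ι ℂ)
    {k : ℕ} {c : ℝ} (hk : k < Fintype.card ι) (K : Submodule ℂ (ι → ℂ))
    (hK : Fintype.card ι ≤ Module.finrank ℂ K + k)
    (h : ∀ x ∈ K, ‖WithLp.toLp 2 (M *ᵥ x)‖ ≤ c * ‖WithLp.toLp 2 x‖) : singVal M k ≤ c := by
  refine LinearMap.singularValues_le_of_submodule _ (by rwa [finrank_euclideanSpace])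
    (K.map ((WithLp.linearEquiv 2 ℂ (ι → ℂ)).symm : (ι → ℂ) →ₗ[ℂ] _)) ?_ ?_
  · rwa [finrank_euclideanSpace, LinearEquiv.finrank_map_eq]
  · rintro _ ⟨x, hx, rfl⟩
    exact h x hx

theorem singVal_nonneg {ι : Type*} [Fintype ι] [DecidableEq ι] (M : Matrix ι ι ℂ) (k : ℕ) :
    0 ≤ singVal M k := LinearMap.singularValues_nonneg _ _

theorem singVal_of_card_le {ι : Type*} [Fintype ι] [DecidableEq ι] (M : Matrix ι ι ℂ) {k : ℕ}
    (h : Fintype.card ι ≤ k) : singVal M k = 0 :=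
  LinearMap.singularValues_of_finrank_le _ (by rwa [finrank_euclideanSpace])

theorem norm_mulVec_le_norm2 (Δ : Matrix (Fin n) (Fin n) ℂ) (x : Fin n → ℂ) :
    ‖WithLp.toLp 2 (Δ *ᵥ x)‖ ≤ norm2 Δ * ‖WithLp.toLp 2 x‖ :=
  (Matrix.toEuclideanCLM (n := Fin n) (𝕜 := ℂ) Δ).le_opNorm (WithLp.toLp 2 x)

theorem norm_toLp_prod_sq (x : Fin r × Fin n → ℂ) :
    ‖WithLp.toLp 2 x‖ ^ 2 = ∑ i, ‖WithLp.toLp 2 (fun a => x (i, a))‖ ^ 2 := by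
  simp only [EuclideanSpace.norm_sq_eq, Fintype.sum_prod_type]

theorem norm_one_kronecker_mulVec_le (Δ : Matrix (Fin n) (Fin n) ℂ) (x : Fin r × Fin n → ℂ) :
    ‖WithLp.toLp 2 (((1 : Matrix (Fin r) (Fin r) ℂ) ⊗ₖ Δ) *ᵥ x)‖ ≤
      norm2 Δ * ‖WithLp.toLp 2 x‖ := by
  have h0 : 0 ≤ norm2 Δ := norm_nonneg _
  refine le_of_sq_le_sq ?_ (mul_nonneg h0 (norm_nonneg _))
  rw [mul_pow, norm_toLp_prod_sq, norm_toLp_prod_sq, Finset.mul_sum]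
  refine Finset.sum_le_sum fun i _ => ?_
  rw [← mul_pow]
  have : (fun a => (((1 : Matrix (Fin r) (Fin r) ℂ) ⊗ₖ Δ) *ᵥ x) (i, a)) =
      Δ *ᵥ fun a => x (i, a) := by
    ext a
    simp [Matrix.mulVec, dotProduct, Fintype.sum_prod_type, Matrix.one_apply, ite_mul]
  rw [this]
  gcongr
  exact norm_mulVec_le_norm2 Δ _

theorem blockEval_map_C (K : Matrix (Fin r) (Fin r) ℂ) (Δ : Matrix (Fin n) (Fin n) ℂ) :
    blockEval K (Δ.map (C : ℂ → ℂ[X])) = (1 : Matrix (Fin r) (Fin r) ℂ) ⊗ₖ Δ := by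
  ext ⟨i, a⟩ ⟨l, b⟩
  simp [blockEval, Matrix.algebraMap_matrix_apply, Matrix.one_apply, eq_comm]

theorem sigmaQ_le_norm2 (hr : 1 ≤ r) (A : Fin (m + 1) → Matrix (Fin n) (Fin n) ℂ) (μ : ℂ)
    (Γ : Params r) (Δ : Matrix (Fin n) (Fin n) ℂ)
    (hΔ : (r : ℕ∞) ≤ algMult (matPoly A + Δ.map (C : ℂ → ℂ[X])) μ) :
    sigmaQ A r μ Γ ≤ norm2 Δ := by
  have hcard : Fintype.card (Fin r × Fin n) = r * n := by simp
  -- For `n = 0` the matrix is empty and its singular values take the default value `0`.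
  rcases Nat.eq_zero_or_pos n with rfl | hn
  · rw [sigmaQ, sigmaNeg, singVal_of_card_le _ (by simp)]
    exact norm_nonneg _
  have hrn : r ≤ r * n := Nat.le_mul_of_pos_right r hn
  have hrank := rank_blockEval_add_le μ Γ _ (pow_dvd_of_le_emultiplicity hΔ)
  rw [blockEval_add, blockEval_map_C, ← Qmat_eq_blockEval] at hrank
  have hker := finrank_ker_mulVecLin_add_rank
    (Qmat A (fun _ => μ) Γ + (1 : Matrix (Fin r) (Fin r) ℂ) ⊗ₖ Δ)
  rw [sigmaQ, sigmaNeg, hcard]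
  refine singVal_le_of_submodule _ (by omega)
    (LinearMap.ker (Qmat A (fun _ => μ) Γ + (1 : Matrix (Fin r) (Fin r) ℂ) ⊗ₖ Δ).mulVecLin)
    (by omega) fun x hx => ?_
  rw [LinearMap.mem_ker, mulVecLin_apply, add_mulVec, add_eq_zero_iff_eq_neg] at hx
  rw [hx, WithLp.toLp_neg, norm_neg]
  exact norm_one_kronecker_mulVec_le Δ x

/-! ### Invariant pairs force roots of the determinant. -/

theorem isUnit_of_rank_eq_card {ι : Type*} [Fintype ι] [DecidableEq ι] {M : Matrix ι ι ℂ}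
    (h : M.rank = Fintype.card ι) : IsUnit M := by
  rw [← Matrix.mulVec_injective_iff_isUnit]
  have h1 := finrank_ker_mulVecLin_add_rank M
  have h2 : LinearMap.ker M.mulVecLin = ⊥ := Submodule.finrank_eq_zero.1 (by omega)
  exact LinearMap.ker_eq_bot.1 h2

theorem charpoly_Cmat (μ : ℂ) (Γ : Params r) :
    (Cmat (fun _ => μ) Γ).charpoly = (X - C μ) ^ r := by
  rw [charpoly_of_isUpperTriangular]
  · simp [Cmat]
  · intro i j hij
    have hij' : j < i := hij
    rw [Cmat, Matrix.of_apply, if_neg hij'.ne']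
    exact nilPart_apply_of_le Γ hij'.le

theorem pow_dvd_det_of_invariant_pair (A : Fin (m + 1) → Matrix (Fin n) (Fin n) ℂ) (μ : ℂ)
    (Γ : Params r) (Δ : Matrix (Fin n) (Fin n) ℂ) (V : Matrix (Fin n) (Fin r) ℂ)
    (W : Matrix (Fin r) (Fin n) ℂ) (hWV : W * V = 1)
    (h : ∑ j, A j * V * Cmat (fun _ => μ) Γ ^ (j : ℕ) + Δ * V = 0) :
    (X - C μ) ^ r ∣ (matPoly A + Δ.map (C : ℂ → ℂ[X])).det := by
  set K := Cmat (fun _ => μ) Γ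
  set P := matPoly A + Δ.map (C : ℂ → ℂ[X])
  set V' := V.map (C : ℂ → ℂ[X])
  set W' := W.map (C : ℂ → ℂ[X])
  have hWV' : W' * V' = 1 := by
    rw [← Matrix.map_mul, hWV, Matrix.map_one _ C_0 C_1]
  -- The geometric-sum quotient of `λ^j - K^j` by `λ - K`. The hypothesis turns `PV` into a
  -- combination of these differences, so `PV = R(λ - K)`.
  let G : ℕ → Matrix (Fin r) (Fin r) ℂ[X] := fun j => ∑ i ∈ Finset.range j,
    (Matrix.scalar (Fin r) (X : ℂ[X])) ^ i * (C : ℂ →+* ℂ[X]).mapMatrix K ^ (j - 1 - i)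
  have hG : ∀ j : ℕ, G j * charmatrix K =
      Matrix.scalar (Fin r) (X : ℂ[X]) ^ j - (K ^ j).map (C : ℂ → ℂ[X]) := by
    intro j
    have h1 : Commute (Matrix.scalar (Fin r) (X : ℂ[X])) ((C : ℂ →+* ℂ[X]).mapMatrix K) :=
      Matrix.scalar_commute _ (fun _ => Commute.all _ _) _
    have h2 := h1.geom_sum₂_mul j
    rw [← map_pow (C : ℂ →+* ℂ[X]).mapMatrix] at h2
    exact h2
  let R : Matrix (Fin n) (Fin r) ℂ[X] := ∑ j, (A j * V).map (C : ℂ → ℂ[X]) * G j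
  have hPV : P * V' = R * charmatrix K := by
    have h3 := congrArg (fun M : Matrix (Fin n) (Fin r) ℂ => M.map (C : ℂ → ℂ[X])) h
    have h4 : ∑ j, (A j * V).map (C : ℂ → ℂ[X]) * (K ^ (j : ℕ)).map (C : ℂ → ℂ[X]) +
        Δ.map (C : ℂ → ℂ[X]) * V' = 0 := by
      ext x y
      have h5 := congrFun (congrFun h3 x) y
      simp only [Matrix.map_apply, Matrix.add_apply, Matrix.sum_apply, map_add, map_sum,
        Matrix.zero_apply, map_zero] at h5
      rw [Matrix.add_apply, Matrix.sum_apply, ← Matrix.map_mul, Matrix.zero_apply, ← h5]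
      simp only [← Matrix.map_mul, Matrix.map_apply]
    have h6 : matPoly A * V' = ∑ j : Fin (m + 1), (A j * V).map (C : ℂ → ℂ[X]) *
        Matrix.scalar (Fin r) (X : ℂ[X]) ^ (j : ℕ) := by
      rw [matPoly, Matrix.sum_mul]
      refine Finset.sum_congr rfl fun j _ => ?_
      rw [← map_pow, ← (Matrix.scalar_comm _ (fun _ => Commute.all _ _) _), Matrix.map_mul,
        Matrix.smul_mul]
      ext x y
      simp [V']
    simp only [P, R, Matrix.add_mul, Matrix.sum_mul, Matrix.mul_assoc, hG, Matrix.mul_sub,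
      Finset.sum_sub_distrib]
    rw [h6, sub_eq_add_neg, add_right_inj, eq_neg_iff_add_eq_zero, add_comm]
    exact h4
  -- With `WV = 1`, the last factor acts as `λ - K` on the range of `V` and as the identity on the
  -- kernel of `W`. Its determinant is the characteristic polynomial of `K`, without completing `V`
  -- to a basis.
  have hfac : P = (P * (1 - V' * W') + R * W') * (1 + V' * ((charmatrix K - 1) * W')) := by
    have e1 : ∀ Z : Matrix (Fin r) (Fin n) ℂ[X], P * (V' * Z) = R * (charmatrix K * Z) :=
      fun Z => by rw [← Matrix.mul_assoc, hPV, Matrix.mul_assoc]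
    have e2 : ∀ Z : Matrix (Fin r) (Fin n) ℂ[X], W' * (V' * Z) = Z := fun Z => by
      rw [← Matrix.mul_assoc, hWV', Matrix.one_mul]
    simp only [Matrix.mul_add, Matrix.add_mul, Matrix.mul_sub, Matrix.sub_mul, Matrix.mul_one,
      Matrix.one_mul, Matrix.mul_assoc, e2, e1]
    abel
  rw [hfac, det_mul, det_one_add_mul_comm, Matrix.mul_assoc, hWV', Matrix.mul_one,
    add_sub_cancel, ← Matrix.charpoly, charpoly_Cmat]
  exact dvd_mul_left _ _

/-! ### Sensitivity, the commutator identity and equality of Gram matrices. -/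

theorem Qmat_mulVec_vec (A : Fin (m + 1) → Matrix (Fin n) (Fin n) ℂ) (μ : Fin r → ℂ)
    (Γ : Params r) (V : Matrix (Fin n) (Fin r) ℂ) :
    Qmat A μ Γ *ᵥ V.vec = (∑ j, A j * V * Cmat μ Γ ^ (j : ℕ)).vec := by
  rw [Qmat, Matrix.sum_mulVec, Matrix.vec_sum]
  refine Finset.sum_congr rfl fun j _ => ?_
  rw [kronecker_mulVec_vec, transpose_transpose]

theorem star_vec_vecMul_Qmat (A : Fin (m + 1) → Matrix (Fin n) (Fin n) ℂ) (μ : Fin r → ℂ)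
    (Γ : Params r) (U : Matrix (Fin n) (Fin r) ℂ) :
    star U.vec ᵥ* Qmat A μ Γ = ((∑ j : Fin (m + 1), Cmat μ Γ ^ (j : ℕ) * Uᴴ * A j)ᵀ).vec := by
  rw [Qmat, Matrix.vecMul_sum, Matrix.transpose_sum, Matrix.vec_sum]
  refine Finset.sum_congr rfl fun j _ => ?_
  rw [star_vec, vec_vecMul_kronecker, transpose_mul, transpose_mul, Matrix.mul_assoc]
  rfl

/-- The matrix `S` for which `trace (E * S)` is the derivative of `U^* 𝒬 V` in the direction `E`
of a variation of `C(μ,Γ)`. -/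
noncomputable def sensitivity (A : Fin (m + 1) → Matrix (Fin n) (Fin n) ℂ)
    (K : Matrix (Fin r) (Fin r) ℂ) (U V : Matrix (Fin n) (Fin r) ℂ) :
    Matrix (Fin r) (Fin r) ℂ :=
  ∑ j : Fin (m + 1), ∑ i ∈ Finset.range j, K ^ i * (Uᴴ * A j * V) * K ^ ((j : ℕ) - 1 - i)

/-- For each `j` the sum telescopes between `K^j (U*A_jV)` and `(U*A_jV) K^j`. -/
theorem commutator_sensitivity (A : Fin (m + 1) → Matrix (Fin n) (Fin n) ℂ)
    (K : Matrix (Fin r) (Fin r) ℂ) (U V : Matrix (Fin n) (Fin r) ℂ) :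
    K * sensitivity A K U V - sensitivity A K U V * K =
      (∑ j : Fin (m + 1), K ^ (j : ℕ) * Uᴴ * A j) * V -
        Uᴴ * ∑ j : Fin (m + 1), A j * V * K ^ (j : ℕ) := by
  simp only [sensitivity, Matrix.mul_sum, Matrix.sum_mul, ← Finset.sum_sub_distrib]
  refine Finset.sum_congr rfl fun j _ => ?_
  have h := Finset.sum_range_sub (fun i => K ^ i * (Uᴴ * A j * V) * K ^ ((j : ℕ) - i)) (j : ℕ)
  simp only [Nat.sub_self, Nat.sub_zero, pow_zero, Matrix.one_mul, Matrix.mul_one] at h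
  have e0 : K ^ (j : ℕ) * Uᴴ * A j * V - Uᴴ * (A j * V * K ^ (j : ℕ)) =
      K ^ (j : ℕ) * (Uᴴ * A j * V) - Uᴴ * A j * V * K ^ (j : ℕ) := by
    simp only [Matrix.mul_assoc]
  rw [e0, ← h]
  refine Finset.sum_congr rfl fun i hi => ?_
  rw [Finset.mem_range] at hi
  have e1 : (j : ℕ) - i = (j - 1 - i) + 1 := by omega
  have e2 : (j : ℕ) - (i + 1) = j - 1 - i := by omega
  rw [e1, e2, pow_succ' K i, pow_succ K (_ - _)]
  simp only [Matrix.mul_assoc]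

theorem gram_eq_gram_of_sensitivity (A : Fin (m + 1) → Matrix (Fin n) (Fin n) ℂ) (μ : ℂ)
    (Γ : Params r) (U V : Matrix (Fin n) (Fin r) ℂ) {σ : ℝ} (hσ : σ ≠ 0)
    (hV : ∑ j : Fin (m + 1), A j * V * Cmat (fun _ => μ) Γ ^ (j : ℕ) = (σ : ℂ) • U)
    (hU : ∑ j : Fin (m + 1), Cmat (fun _ => μ) Γ ^ (j : ℕ) * Uᴴ * A j = (σ : ℂ) • Vᴴ)
    (hS : ∀ i k, i < k → sensitivity A (Cmat (fun _ => μ) Γ) U V k i = 0) :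
    Uᴴ * U = Vᴴ * V := by
  set S := sensitivity A (Cmat (fun _ => μ) Γ) U V
  have h1 := commutator_sensitivity A (Cmat (fun _ => μ) Γ) U V
  rw [hV, hU, Cmat_eq_add_nilPart, Matrix.smul_mul, Matrix.mul_smul, ← smul_sub,
    ← Cmat_eq_add_nilPart] at h1
  -- The scalar part `μ` of `C` commutes with `S`. What remains is the commutator of a strictly
  -- upper with an upper triangular matrix, zero on and below the diagonal.
  have h2 : ∀ i k, k ≤ i → (Vᴴ * V - Uᴴ * U) i k = 0 := by
    intro i k hki
    have h3 := congrFun (congrFun h1 i) k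
    rw [Cmat_eq_add_nilPart, Matrix.add_mul, Matrix.mul_add,
      Algebra.commutes μ (sensitivity A _ U V), add_sub_add_left_eq_sub,
      ← Cmat_eq_add_nilPart] at h3
    have h4 : (nilPart Γ * S) i k = 0 := by
      rw [Matrix.mul_apply]
      refine Finset.sum_eq_zero fun q _ => ?_
      by_cases hq : q ≤ i
      · rw [nilPart_apply_of_le Γ hq, zero_mul]
      · rw [hS k q (lt_of_le_of_lt hki (not_le.1 hq)), mul_zero]
    have h5 : (S * nilPart Γ) i k = 0 := by
      rw [Matrix.mul_apply]
      refine Finset.sum_eq_zero fun q _ => ?_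
      by_cases hq : k ≤ q
      · rw [nilPart_apply_of_le Γ hq, mul_zero]
      · rw [hS q i (lt_of_lt_of_le (not_le.1 hq) hki), zero_mul]
    rw [Matrix.sub_apply, h4, h5, sub_zero, Matrix.smul_apply, smul_eq_mul] at h3
    exact (mul_eq_zero.1 h3.symm).resolve_left (Complex.ofReal_ne_zero.2 hσ)
  have hherm : (Vᴴ * V - Uᴴ * U).IsHermitian :=
    (isHermitian_conjTranspose_mul_self V).sub (isHermitian_conjTranspose_mul_self U)
  have h6 : Vᴴ * V - Uᴴ * U = 0 := by
    ext i k
    rcases le_total k i with h | h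
    · exact h2 i k h
    · rw [← hherm.apply, h2 k i h, star_zero, Matrix.zero_apply]
  exact (sub_eq_zero.1 h6).symm

open scoped Matrix.Norms.L2Operator in
-- Equal Gram matrices turn `(UV⁺)*(UV⁺)` into `VV⁺`, an orthogonal projection; the C*-identity
-- finishes.
theorem norm2_mul_pinv_le (U V : Matrix (Fin n) (Fin r) ℂ) (hUV : Uᴴ * U = Vᴴ * V)
    (hV : IsUnit (Vᴴ * V)) : norm2 (U * ((Vᴴ * V)⁻¹ * Vᴴ)) ≤ 1 := by
  have hdet := (Matrix.isUnit_iff_isUnit_det _).1 hV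
  set H := Vᴴ * V with hH
  have hHH : Hᴴ = H := (isHermitian_conjTranspose_mul_self V)
  set Q := V * (H⁻¹ * Vᴴ) with hQ
  have hQH : Qᴴ = Q := by
    simp only [hQ, conjTranspose_mul, conjTranspose_conjTranspose, conjTranspose_nonsing_inv, hHH,
      Matrix.mul_assoc]
  have hQQ : Q * Q = Q := by
    calc Q * Q = V * (H⁻¹ * (Vᴴ * V) * (H⁻¹ * Vᴴ)) := by simp only [hQ, Matrix.mul_assoc]
      _ = Q := by rw [← hH, nonsing_inv_mul _ hdet, Matrix.one_mul]
  have hQn : ‖Q‖ ≤ 1 := by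
    have h1 := l2_opNorm_conjTranspose_mul_self Q
    rw [hQH, hQQ] at h1
    by_contra hlt
    nlinarith [norm_nonneg Q]
  have h2 := l2_opNorm_conjTranspose_mul_self (U * (H⁻¹ * Vᴴ))
  have h3 : (U * (H⁻¹ * Vᴴ))ᴴ * (U * (H⁻¹ * Vᴴ)) = Q := by
    calc (U * (H⁻¹ * Vᴴ))ᴴ * (U * (H⁻¹ * Vᴴ)) = V * (H⁻¹ * (Uᴴ * U * H⁻¹) * Vᴴ) := by
          simp only [conjTranspose_mul, conjTranspose_conjTranspose, conjTranspose_nonsing_inv,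
            hHH, Matrix.mul_assoc]
      _ = Q := by rw [hUV, mul_nonsing_inv _ hdet, Matrix.mul_one]
  rw [h3] at h2
  change ‖U * (H⁻¹ * Vᴴ)‖ ≤ 1
  by_contra hlt
  nlinarith [norm_nonneg (U * (H⁻¹ * Vᴴ))]

/-! ### Variation of `𝒬` in `Γ` and stationarity at an optimum. -/

theorem nilPart_add_smul (Γ Θ : Params r) (z : ℂ) :
    nilPart (Γ + z • Θ) = nilPart Γ + z • nilPart Θ := by
  ext i k
  by_cases h : i < k <;> simp [nilPart, gam, h]

/-- The real-linear map `M ↦ Mᵀ ⊗ B` into the operators on Euclidean space. -/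
noncomputable def transposeKroneckerCLM (r : ℕ) (B : Matrix (Fin n) (Fin n) ℂ) :
    Matrix (Fin r) (Fin r) ℂ →ₗ[ℝ]
      (EuclideanSpace ℂ (Fin r × Fin n) →L[ℂ] EuclideanSpace ℂ (Fin r × Fin n)) where
  toFun M := Matrix.toEuclideanCLM (n := Fin r × Fin n) (𝕜 := ℂ) (Mᵀ ⊗ₖ B)
  map_add' M M' := by rw [transpose_add, add_kronecker, map_add]
  map_smul' c M := by
    rw [transpose_smul, smul_kronecker, ← Complex.coe_smul, map_smul]
    rfl

open scoped Matrix.Norms.L2Operator in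
theorem hasDerivAt_toEuclideanCLM_pow_kronecker {M : ℝ → Matrix (Fin r) (Fin r) ℂ}
    {M' : Matrix (Fin r) (Fin r) ℂ} {t : ℝ} (h : HasDerivAt M M' t)
    (B : Matrix (Fin n) (Fin n) ℂ) (j : ℕ) :
    HasDerivAt (fun t : ℝ => Matrix.toEuclideanCLM (n := Fin r × Fin n) (𝕜 := ℂ)
        ((M t ^ j)ᵀ ⊗ₖ B))
      (Matrix.toEuclideanCLM (n := Fin r × Fin n) (𝕜 := ℂ)
        ((∑ i ∈ Finset.range j, M t ^ (j - 1 - i) * M' * M t ^ i)ᵀ ⊗ₖ B)) t :=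
  (LinearMap.toContinuousLinearMap (transposeKroneckerCLM r B)).hasFDerivAt.comp_hasDerivAt t
    (h.fun_pow' j)

open scoped Matrix.Norms.L2Operator in
theorem hasDerivAt_toEuclideanCLM_Qmat (A : Fin (m + 1) → Matrix (Fin n) (Fin n) ℂ) (μ : ℂ)
    (Γ Θ : Params r) :
    HasDerivAt (fun t : ℝ => Matrix.toEuclideanCLM (n := Fin r × Fin n) (𝕜 := ℂ)
        (Qmat A (fun _ => μ) (Γ + (t : ℂ) • Θ)))
      (Matrix.toEuclideanCLM (n := Fin r × Fin n) (𝕜 := ℂ) (∑ j : Fin (m + 1),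
        (∑ i ∈ Finset.range j, Cmat (fun _ => μ) Γ ^ ((j : ℕ) - 1 - i) * nilPart Θ *
          Cmat (fun _ => μ) Γ ^ i)ᵀ ⊗ₖ A j)) 0 := by
  have h1 : HasDerivAt (fun t : ℝ => Cmat (fun _ => μ) (Γ + (t : ℂ) • Θ)) (nilPart Θ) 0 := by
    have h2 : (fun t : ℝ => Cmat (fun _ => μ) (Γ + (t : ℂ) • Θ)) =
        fun t : ℝ => Cmat (fun _ => μ) Γ + (t : ℂ) • nilPart Θ := by
      funext t
      rw [Cmat_eq_add_nilPart, Cmat_eq_add_nilPart, nilPart_add_smul, add_assoc]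
    rw [h2]
    have h3 : HasDerivAt (fun t : ℝ => (t : ℂ)) 1 0 := Complex.ofRealCLM.hasDerivAt
    simpa using (h3.smul_const (nilPart Θ)).const_add (Cmat (fun _ => μ) Γ)
  simp only [Qmat, map_sum]
  refine HasDerivAt.fun_sum fun j _ => ?_
  simpa only [Complex.ofReal_zero, zero_smul, add_zero] using
    hasDerivAt_toEuclideanCLM_pow_kronecker h1 (A j) (j : ℕ)

theorem norm_toLp_eq_one_of_star_dotProduct {ι : Type*} [Fintype ι] {x : ι → ℂ}
    (h : star x ⬝ᵥ x = 1) : ‖WithLp.toLp 2 x‖ = 1 := by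
  have h1 : inner ℂ (WithLp.toLp 2 x) (WithLp.toLp 2 x) = (1 : ℂ) := by
    rw [EuclideanSpace.inner_eq_star_dotProduct, dotProduct_comm]
    exact h
  rw [inner_self_eq_norm_sq_to_K] at h1
  have h2 : ‖WithLp.toLp 2 x‖ ^ 2 = 1 := by
    apply Complex.ofReal_injective
    push_cast
    exact h1
  exact (pow_eq_one_iff_of_nonneg (norm_nonneg _) two_ne_zero).1 h2

theorem exists_lt_singVal_of_hasDerivAt {ι : Type*} [Fintype ι] [DecidableEq ι]
    {M : ℝ → Matrix ι ι ℂ} {D : Matrix ι ι ℂ}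
    (hM : HasDerivAt (fun t => Matrix.toEuclideanCLM (n := ι) (𝕜 := ℂ) (M t))
      (Matrix.toEuclideanCLM (n := ι) (𝕜 := ℂ) D) 0) {k : ℕ} (hk : k < Fintype.card ι)
    (hsimple : ∀ j < Fintype.card ι, singVal (M 0) j = singVal (M 0) k → j = k)
    {u v : ι → ℂ} (hv : star v ⬝ᵥ v = 1) (hMv : M 0 *ᵥ v = (singVal (M 0) k : ℂ) • u)
    (hMu : (M 0)ᴴ *ᵥ u = (singVal (M 0) k : ℂ) • v) (hσ : 0 < singVal (M 0) k)
    (hpos : 0 < (star u ⬝ᵥ (D *ᵥ v)).re) : ∃ t, singVal (M 0) k < singVal (M t) k := by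
  have hfr : Module.finrank ℂ (EuclideanSpace ℂ ι) = Fintype.card ι := finrank_euclideanSpace
  refine exists_lt_singularValues_of_hasDerivAt hM ⟨k, hfr ▸ hk⟩
    (fun j hj => Fin.ext (hsimple j (hfr ▸ j.2) hj)) (norm_toLp_eq_one_of_star_dotProduct hv) ?_ ?_
  · change LinearMap.adjoint (Matrix.toEuclideanLin (M 0)) (WithLp.toLp 2 (M 0 *ᵥ v)) =
      ((singVal (M 0) k : ℂ) ^ 2) • WithLp.toLp 2 v
    rw [hMv, ← toEuclideanLin_conjTranspose_eq_adjoint, toLpLin_toLp, toLin'_apply, mulVec_smul,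
      hMu, smul_smul, ← pow_two, WithLp.toLp_smul]
  · rw [toEuclideanCLM_toLp, toEuclideanCLM_toLp, hMv, EuclideanSpace.inner_eq_star_dotProduct]
    simp only [star_smul, dotProduct_smul, Complex.star_def, Complex.conj_ofReal, smul_eq_mul]
    rw [Complex.re_ofReal_mul, dotProduct_comm]
    exact mul_pos hσ hpos

/-- Cyclicity of the trace collects the powers of `K` around the direction `N` into the sensitivity
matrix. -/
theorem star_vec_dotProduct_derivative (A : Fin (m + 1) → Matrix (Fin n) (Fin n) ℂ)
    (K : Matrix (Fin r) (Fin r) ℂ) (U V : Matrix (Fin n) (Fin r) ℂ)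
    (N : Matrix (Fin r) (Fin r) ℂ) :
    star U.vec ⬝ᵥ ((∑ j : Fin (m + 1), (∑ i ∈ Finset.range j, K ^ ((j : ℕ) - 1 - i) * N *
      K ^ i)ᵀ ⊗ₖ A j) *ᵥ V.vec) = (sensitivity A K U V * N).trace := by
  rw [Matrix.sum_mulVec]
  simp only [kronecker_mulVec_vec, transpose_transpose]
  rw [← Matrix.vec_sum, star_vec_dotProduct_vec, sensitivity]
  simp only [Matrix.mul_sum, Matrix.sum_mul, Matrix.trace_sum]
  refine Finset.sum_congr rfl fun j _ => Finset.sum_congr rfl fun i _ => ?_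
  have e1 : Uᴴ * (A j * V * (K ^ ((j : ℕ) - 1 - i) * N * K ^ i)) =
      (Uᴴ * A j * V * K ^ ((j : ℕ) - 1 - i) * N) * K ^ i := by
    simp only [Matrix.mul_assoc]
  rw [e1, trace_mul_comm]
  simp only [Matrix.mul_assoc]

theorem sensitivity_eq_zero_of_isOptimal (hr : 1 ≤ r)
    (A : Fin (m + 1) → Matrix (Fin n) (Fin n) ℂ) (μ : ℂ) (Γ : Params r)
    (hopt : IsOptimal A r μ Γ) (hmult : MultiplicityAssumption A r μ Γ)
    (hσ : 0 < sigmaQ A r μ Γ) (U V : Matrix (Fin n) (Fin r) ℂ)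
    (hV1 : star V.vec ⬝ᵥ V.vec = 1)
    (hV : Qmat A (fun _ => μ) Γ *ᵥ V.vec = (sigmaQ A r μ Γ : ℂ) • U.vec)
    (hU : star U.vec ᵥ* Qmat A (fun _ => μ) Γ = (sigmaQ A r μ Γ : ℂ) • star V.vec)
    {a b : Fin r} (hab : a < b) : sensitivity A (Cmat (fun _ => μ) Γ) U V b a = 0 := by
  by_contra hne
  set S := sensitivity A (Cmat (fun _ => μ) Γ) U V
  set Q := Qmat A (fun _ => μ) Γ
  set σ := sigmaQ A r μ Γ
  -- The conjugate makes the derivative in this direction equal to `|S b a|²`, hence positive unless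
  -- the entry vanishes.
  let Θ : Params r := Pi.single ⟨(b, a), hab⟩ (star (S b a))
  have hΘ : nilPart Θ = Matrix.single a b (star (S b a)) := by
    ext i k
    by_cases hik : i < k
    · simp only [nilPart, Matrix.of_apply, gam, hik, dif_pos, Θ, Pi.single_apply,
        Matrix.single_apply, Subtype.mk.injEq, Prod.mk.injEq]
      refine if_congr ?_ rfl rfl
      tauto
    · rw [nilPart_apply_of_le _ (not_lt.1 hik), Matrix.single_apply, if_neg]
      rintro ⟨rfl, rfl⟩
      exact hik hab
  have hcard : Fintype.card (Fin r × Fin n) = r * n := by simp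
  obtain ⟨hsub, ⟨k0⟩⟩ := Nat.card_eq_one_iff_unique.1 hmult
  -- A singular value of multiplicity one exists only if the matrix is nonempty.
  have hn : 0 < r * n := hcard ▸ (Nat.zero_le _).trans_lt k0.1.2
  have hk : Fintype.card (Fin r × Fin n) - r < Fintype.card (Fin r × Fin n) := by omega
  have hsimple : ∀ j < Fintype.card (Fin r × Fin n),
      singVal Q j = singVal Q (Fintype.card (Fin r × Fin n) - r) →
        j = Fintype.card (Fin r × Fin n) - r := by
    intro j hj hjk
    have h1 := hsub.elim ⟨⟨j, hj⟩, hjk⟩ ⟨⟨_, hk⟩, rfl⟩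
    exact congrArg (fun x => (x.1 : ℕ)) h1
  have hQU : Qᴴ *ᵥ U.vec = (σ : ℂ) • V.vec := by
    have h2 := congrArg star hU
    rw [star_vecMul, star_star, star_smul, star_star] at h2
    simpa using h2
  have hQ0 : Qmat A (fun _ => μ) (Γ + ((0 : ℝ) : ℂ) • Θ) = Q := by simp [Q]
  obtain ⟨t, ht⟩ := exists_lt_singVal_of_hasDerivAt (hasDerivAt_toEuclideanCLM_Qmat A μ Γ Θ) hk
    (by rwa [hQ0]) hV1 (by rwa [hQ0]) (by rwa [hQ0]) (by rwa [hQ0])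
    (by
      rw [star_vec_dotProduct_derivative, hΘ, trace_mul_single, op_smul_eq_mul,
        Complex.star_def, Complex.mul_conj, Complex.ofReal_re]
      exact Complex.normSq_pos.2 hne)
  rw [hQ0] at ht
  exact absurd ht (not_lt.2 (hopt (Γ + (t : ℂ) • Θ)))

/-! ### The optimal perturbation and the distance formula. -/

open scoped ComplexOrder in
theorem exists_perturbation (hr : 1 ≤ r) (A : Fin (m + 1) → Matrix (Fin n) (Fin n) ℂ) (μ : ℂ)
    (Γ : Params r) (hopt : IsOptimal A r μ Γ) (hmult : MultiplicityAssumption A r μ Γ)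
    (hlin : LinIndepAssumption A r μ Γ) :
    ∃ Δ : Matrix (Fin n) (Fin n) ℂ,
      (r : ℕ∞) ≤ algMult (matPoly A + Δ.map (C : ℂ → ℂ[X])) μ ∧ norm2 Δ ≤ sigmaQ A r μ Γ := by
  obtain ⟨U, V, -, hV1, hV, hU, hrank⟩ := hlin
  have hσ : 0 ≤ sigmaQ A r μ Γ := singVal_nonneg _ _
  have hVV : IsUnit (Vᴴ * V) :=
    isUnit_of_rank_eq_card (by rw [rank_conjTranspose_mul_self, hrank, Fintype.card_fin])
  have hdet := (Matrix.isUnit_iff_isUnit_det _).1 hVV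
  have hV' : ∑ j : Fin (m + 1), A j * V * Cmat (fun _ => μ) Γ ^ (j : ℕ) =
      (sigmaQ A r μ Γ : ℂ) • U := by
    rw [Qmat_mulVec_vec, ← vec_smul, vec_inj] at hV
    exact hV
  have hU' : ∑ j : Fin (m + 1), Cmat (fun _ => μ) Γ ^ (j : ℕ) * Uᴴ * A j =
      (sigmaQ A r μ Γ : ℂ) • Vᴴ := by
    rw [star_vec_vecMul_Qmat, star_vec, ← vec_smul, vec_inj] at hU
    rw [← transpose_inj, hU]
    rfl
  have hinv : (Vᴴ * V)⁻¹ * Vᴴ * V = 1 := by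
    rw [Matrix.mul_assoc, nonsing_inv_mul _ hdet]
  refine ⟨-((sigmaQ A r μ Γ : ℂ) • (U * ((Vᴴ * V)⁻¹ * Vᴴ))), le_emultiplicity_of_pow_dvd
    (pow_dvd_det_of_invariant_pair A μ Γ _ V ((Vᴴ * V)⁻¹ * Vᴴ) hinv ?_), ?_⟩
  · rw [hV', Matrix.neg_mul, Matrix.smul_mul, Matrix.mul_assoc, hinv, Matrix.mul_one,
      add_neg_cancel]
  · rw [norm2, map_neg, norm_neg, map_smul, norm_smul, Complex.norm_real, Real.norm_of_nonneg hσ]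
    -- If `σ = 0` the perturbation is zero; the stationarity argument requires `σ > 0`.
    rcases hσ.eq_or_lt with h0 | h0
    · rw [← h0, zero_mul]
    · refine mul_le_of_le_one_right hσ (norm2_mul_pinv_le U V ?_ hVV)
      exact gram_eq_gram_of_sensitivity A μ Γ U V h0.ne' hV' hU' fun i k hik =>
        sensitivity_eq_zero_of_isOptimal hr A μ Γ hopt hmult h0 U V hV1 hV hU hik

theorem distMult_eq_iSup (hr : 1 ≤ r) (A : Fin (m + 1) → Matrix (Fin n) (Fin n) ℂ) (μ : ℂ)
    (h : ∃ Γ : Params r, IsOptimal A r μ Γ ∧ MultiplicityAssumption A r μ Γ ∧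
      LinIndepAssumption A r μ Γ) :
    distMult A r μ = ⨆ Γ : Params r, ENNReal.ofReal (sigmaQ A r μ Γ) := by
  apply le_antisymm
  · obtain ⟨Γ, hopt, hmult, hlin⟩ := h
    obtain ⟨Δ, hΔ, hnorm⟩ := exists_perturbation hr A μ Γ hopt hmult hlin
    exact (iInf₂_le Δ hΔ).trans ((ENNReal.ofReal_le_ofReal hnorm).trans
      (le_iSup (fun Γ : Params r => ENNReal.ofReal (sigmaQ A r μ Γ)) Γ))
  · exact iSup_le fun Γ => le_iInf₂ fun Δ hΔ =>
      ENNReal.ofReal_le_ofReal (sigmaQ_le_norm2 hr A μ Γ Δ hΔ)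

/-! ### Attainment of the supremum: boundedness of superlevel sets. -/

/-- The `p`-th block of a block vector. -/
def seg (z : Fin r × Fin n → ℂ) (p : Fin r) : Fin n → ℂ := fun a => z (p, a)

theorem seg_mulVec (M : Matrix (Fin r × Fin n) (Fin r × Fin n) ℂ) (z : Fin r × Fin n → ℂ)
    (p : Fin r) : seg (M *ᵥ z) p = ∑ q, block M p q *ᵥ seg z q := by
  ext a
  simp [seg, block, Matrix.mulVec, dotProduct, Fintype.sum_prod_type]

theorem norm_seg_le (z : Fin r × Fin n → ℂ) (p : Fin r) :
    ‖WithLp.toLp 2 (seg z p)‖ ≤ ‖WithLp.toLp 2 z‖ := by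
  refine le_of_sq_le_sq ?_ (norm_nonneg _)
  rw [norm_toLp_prod_sq z]
  exact Finset.single_le_sum (f := fun i => ‖WithLp.toLp 2 (fun a => z (i, a))‖ ^ 2)
    (fun _ _ => sq_nonneg _) (Finset.mem_univ p)

theorem norm_le_of_norm_seg_le {z : Fin r × Fin n → ℂ} {c : ℝ} (hc : 0 ≤ c)
    (h : ∀ p, ‖WithLp.toLp 2 (seg z p)‖ ≤ c) : ‖WithLp.toLp 2 z‖ ≤ r * c := by
  refine le_of_sq_le_sq ?_ (by positivity)
  rw [norm_toLp_prod_sq z]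
  calc ∑ i, ‖WithLp.toLp 2 (fun a => z (i, a))‖ ^ 2 ≤ ∑ _i : Fin r, c ^ 2 :=
        Finset.sum_le_sum fun i _ => pow_le_pow_left₀ (norm_nonneg _) (h i) 2
    _ = r * c ^ 2 := by simp
    _ ≤ (r * c) ^ 2 := by
      rw [mul_pow]
      gcongr
      exact_mod_cast Nat.le_self_pow two_ne_zero r

/-- A block lower triangular matrix all of whose diagonal blocks are equal to `Z`. -/
structure IsBlockLower (M : Matrix (Fin r × Fin n) (Fin r × Fin n) ℂ)
    (Z : Matrix (Fin n) (Fin n) ℂ) : Prop where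
  upper : ∀ p q, p < q → block M p q = 0
  diag : ∀ p, block M p p = Z

theorem IsBlockLower.seg_mulVec_eq {M : Matrix (Fin r × Fin n) (Fin r × Fin n) ℂ}
    {Z : Matrix (Fin n) (Fin n) ℂ} (h : IsBlockLower M Z) {z : Fin r × Fin n → ℂ} {p : Fin r}
    (hz : ∀ q < p, seg z q = 0) : seg (M *ᵥ z) p = Z *ᵥ seg z p := by
  rw [seg_mulVec, Finset.sum_eq_single p, h.diag]
  · intro q _ hq
    rcases lt_or_gt_of_ne hq with hlt | hlt
    · rw [hz q hlt, mulVec_zero]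
    · rw [h.upper p q hlt, zero_mulVec]
  · simp

/-- Forward substitution through the invertible diagonal block. -/
theorem IsBlockLower.seg_eq_zero {M : Matrix (Fin r × Fin n) (Fin r × Fin n) ℂ}
    {Z : Matrix (Fin n) (Fin n) ℂ} (h : IsBlockLower M Z) (hZ : IsUnit Z)
    {z : Fin r × Fin n → ℂ} {k : ℕ} (hz : ∀ p : Fin r, (p : ℕ) < k → seg (M *ᵥ z) p = 0)
    (p : Fin r) (hp : (p : ℕ) < k) : seg z p = 0 := by
  induction p using WellFoundedLT.induction with
  | _ p ih =>
    have h1 : Z *ᵥ seg z p = 0 := by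
      rw [← h.seg_mulVec_eq fun q hq => ih q hq (lt_trans (Fin.lt_def.1 hq) hp)]
      exact hz p hp
    exact mulVec_injective_iff_isUnit.2 hZ (by rw [h1, mulVec_zero])

theorem IsBlockLower.isUnit {M : Matrix (Fin r × Fin n) (Fin r × Fin n) ℂ}
    {Z : Matrix (Fin n) (Fin n) ℂ} (h : IsBlockLower M Z) (hZ : IsUnit Z) : IsUnit M := by
  rw [← mulVec_injective_iff_isUnit]
  refine (injective_iff_map_eq_zero M.mulVecLin).2 fun z hz => funext fun x => ?_
  rw [mulVecLin_apply] at hz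
  exact congrFun (h.seg_eq_zero hZ (k := r) (fun p _ => by rw [hz]; rfl) x.1 x.1.2) x.2

/-- If the blocks in column `l` above row `i` are bounded by `c` and the block at `(i, l)` is
bounded below by `T`, then at least `n` singular values are small. -/
theorem singVal_le_of_isBlockLower (hrn : r ≤ n)
    {M Q : Matrix (Fin r × Fin n) (Fin r × Fin n) ℂ} {Z : Matrix (Fin n) (Fin n) ℂ}
    (h : IsBlockLower M Z) (hZ : IsUnit Z) {δ c T : ℝ}
    (hδ : ∀ x, ‖WithLp.toLp 2 (Q *ᵥ x)‖ ≤ ‖WithLp.toLp 2 (M *ᵥ x)‖ + δ * ‖WithLp.toLp 2 x‖)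
    {i l : Fin r} (hli : l < i) (hc : 0 ≤ c) (hT : 0 < T)
    (hcol : ∀ p < i, ∀ u, ‖WithLp.toLp 2 (block M p l *ᵥ u)‖ ≤ c * ‖WithLp.toLp 2 u‖)
    (hil : ∀ u, T * ‖WithLp.toLp 2 u‖ ≤ ‖WithLp.toLp 2 (block M i l *ᵥ u)‖) :
    sigmaNeg r Q ≤ r * c * norm2 Z / T + δ := by
  have hM := h.isUnit hZ
  have hMdet := (Matrix.isUnit_iff_isUnit_det _).1 hM
  have hi := i.2
  have hcard : Fintype.card (Fin r × Fin n) = r * n := by simp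
  have hrpos : 0 < r := by omega
  have hrrn : r ≤ r * n := Nat.le_mul_of_pos_right r (by omega)
  -- Block column `l` cut off from row `i` on. Its preimage `L u` under `M` agrees with `u` placed
  -- in block `l` on all blocks before `i`, while row `i` forces `Z (L u)_i = -M_{il} u`. Thus `L u`
  -- is long although `M (L u) = Y u` stays bounded.
  let Y : (Fin n → ℂ) →ₗ[ℂ] (Fin r × Fin n → ℂ) :=
    { toFun := fun u x => if x.1 < i then (block M x.1 l *ᵥ u) x.2 else 0
      map_add' := fun u v => by ext x; by_cases hx : x.1 < i <;> simp [hx, mulVec_add]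
      map_smul' := fun a u => by ext x; by_cases hx : x.1 < i <;> simp [hx, mulVec_smul] }
  have hYlt : ∀ u p, p < i → seg (Y u) p = block M p l *ᵥ u := fun u p hp => by
    ext a; simp [seg, Y, hp]
  have hYge : ∀ u p, ¬ p < i → seg (Y u) p = 0 := fun u p hp => by
    ext a; simp [seg, Y, hp]
  let L : (Fin n → ℂ) →ₗ[ℂ] (Fin r × Fin n → ℂ) := M⁻¹.mulVecLin ∘ₗ Y
  have hML : ∀ u, M *ᵥ L u = Y u := fun u => by
    simp [L, mulVec_mulVec, mul_nonsing_inv _ hMdet]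
  have hlow : ∀ u, T * ‖WithLp.toLp 2 u‖ ≤ norm2 Z * ‖WithLp.toLp 2 (L u)‖ := by
    intro u
    let e : Fin r × Fin n → ℂ := fun x => if x.1 = l then u x.2 else 0
    have he1 : seg e l = u := by ext a; simp [seg, e]
    have he2 : ∀ p, p ≠ l → seg e p = 0 := fun p hp => by ext a; simp [seg, e, hp]
    have hMe : ∀ p, seg (M *ᵥ e) p = block M p l *ᵥ u := fun p => by
      rw [seg_mulVec, Finset.sum_eq_single l, he1]
      · intro q _ hq
        rw [he2 q hq, mulVec_zero]
      · simp
    have hsub : ∀ (x y : Fin r × Fin n → ℂ) p, seg (x - y) p = seg x p - seg y p :=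
      fun _ _ _ => rfl
    have hz : ∀ p, p < i → seg (L u - e) p = 0 := fun p hp => by
      refine h.seg_eq_zero hZ (k := i) (fun q hq => ?_) p hp
      rw [mulVec_sub, hsub, hML, hMe, hYlt u q hq, sub_self]
    have h1 := h.seg_mulVec_eq hz
    rw [mulVec_sub, hsub, hML, hMe, hYge u i (lt_irrefl i), hsub, he2 i hli.ne', sub_zero,
      zero_sub] at h1
    calc T * ‖WithLp.toLp 2 u‖ ≤ ‖WithLp.toLp 2 (block M i l *ᵥ u)‖ := hil u
      _ = ‖WithLp.toLp 2 (Z *ᵥ seg (L u) i)‖ := by rw [← h1, WithLp.toLp_neg, norm_neg]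
      _ ≤ norm2 Z * ‖WithLp.toLp 2 (seg (L u) i)‖ := norm_mulVec_le_norm2 _ _
      _ ≤ norm2 Z * ‖WithLp.toLp 2 (L u)‖ :=
        mul_le_mul_of_nonneg_left (norm_seg_le _ _) (norm_nonneg _)
  have hinj : Function.Injective L := by
    rw [← LinearMap.ker_eq_bot, LinearMap.ker_eq_bot']
    intro u hu
    have h1 := hlow u
    rw [hu, WithLp.toLp_zero, norm_zero, mul_zero] at h1
    have h2 : ‖WithLp.toLp 2 u‖ ≤ 0 := nonpos_of_mul_nonpos_right h1 hT
    exact congrArg WithLp.ofLp (norm_le_zero_iff.1 h2)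
  rw [sigmaNeg]
  refine singVal_le_of_submodule Q (by omega) (LinearMap.range L) ?_ ?_
  · rw [LinearMap.finrank_range_of_inj hinj, Module.finrank_fintype_fun_eq_card, Fintype.card_fin]
    omega
  · rintro _ ⟨u, rfl⟩
    have h1 : ‖WithLp.toLp 2 (M *ᵥ L u)‖ ≤ r * (c * ‖WithLp.toLp 2 u‖) := by
      rw [hML]
      refine norm_le_of_norm_seg_le (by positivity) fun p => ?_
      by_cases hp : p < i
      · rw [hYlt u p hp]
        exact hcol p hp u
      · rw [hYge u p hp, WithLp.toLp_zero, norm_zero]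
        positivity
    have h2 : ‖WithLp.toLp 2 u‖ ≤ norm2 Z * ‖WithLp.toLp 2 (L u)‖ / T := by
      rw [le_div_iff₀ hT, mul_comm]
      exact hlow u
    calc ‖WithLp.toLp 2 (Q *ᵥ L u)‖
        ≤ ‖WithLp.toLp 2 (M *ᵥ L u)‖ + δ * ‖WithLp.toLp 2 (L u)‖ := hδ _
      _ ≤ r * (c * (norm2 Z * ‖WithLp.toLp 2 (L u)‖ / T)) + δ * ‖WithLp.toLp 2 (L u)‖ := by
        gcongr
        exact h1.trans (by gcongr)
      _ = (r * c * norm2 Z / T + δ) * ‖WithLp.toLp 2 (L u)‖ := by ring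

theorem norm_nilPart_pow_apply_le {Γ : Params r} {d : ℕ} {R : ℝ} (hR : 0 ≤ R)
    (h : ∀ p q : Fin r, (q : ℕ) < p + d → ‖nilPart Γ p q‖ ≤ R) (k : ℕ) (p q : Fin r)
    (hpq : (q : ℕ) < p + d) : ‖(nilPart Γ ^ k) p q‖ ≤ (r * R) ^ k := by
  induction k generalizing p with
  | zero =>
    rw [pow_zero, pow_zero, Matrix.one_apply]
    split_ifs <;> simp
  | succ k ih =>
    rw [pow_succ', Matrix.mul_apply]
    calc _ ≤ ∑ s, ‖nilPart Γ p s * (nilPart Γ ^ k) s q‖ := norm_sum_le _ _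
      _ ≤ ∑ _s : Fin r, R * (r * R) ^ k := by
        refine Finset.sum_le_sum fun s _ => ?_
        rw [norm_mul]
        by_cases hps : s ≤ p
        · rw [nilPart_apply_of_le Γ hps, norm_zero, zero_mul]
          positivity
        · have h1 : (p : ℕ) < s := not_le.1 hps
          by_cases hsq : (q : ℕ) < s + k
          · rw [nilPart_pow_apply_eq_zero Γ k hsq, norm_zero, mul_zero]
            positivity
          · exact mul_le_mul (h p s (by omega)) (ih s (by omega)) (norm_nonneg _) hR
      _ = (r * R) ^ (k + 1) := by
        rw [Finset.sum_const, Finset.card_univ, Fintype.card_fin, nsmul_eq_mul]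
        ring

/-- A path of at least two increasing steps covering distance `d` uses only steps shorter than `d`.
So on the `d`-th superdiagonal only the first power of the nilpotent part sees an uncontrolled
entry. -/
theorem norm_nilPart_pow_add_two_apply_le {Γ : Params r} {d : ℕ} {R : ℝ} (hR : 0 ≤ R)
    (h : ∀ p q : Fin r, (q : ℕ) < p + d → ‖nilPart Γ p q‖ ≤ R) (k : ℕ) (p q : Fin r)
    (hpq : (q : ℕ) = p + d) : ‖(nilPart Γ ^ (k + 2)) p q‖ ≤ (r * R) ^ (k + 2) := by
  rw [pow_succ', Matrix.mul_apply]
  calc _ ≤ ∑ s, ‖nilPart Γ p s * (nilPart Γ ^ (k + 1)) s q‖ := norm_sum_le _ _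
    _ ≤ ∑ _s : Fin r, R * (r * R) ^ (k + 1) := by
      refine Finset.sum_le_sum fun s _ => ?_
      rw [norm_mul]
      by_cases hps : s ≤ p
      · rw [nilPart_apply_of_le Γ hps, norm_zero, zero_mul]
        positivity
      · have h1 : (p : ℕ) < s := not_le.1 hps
        by_cases hsq : (q : ℕ) < s + (k + 1)
        · rw [nilPart_pow_apply_eq_zero Γ _ hsq, norm_zero, mul_zero]
          positivity
        · exact mul_le_mul (h p s (by omega)) (norm_nilPart_pow_apply_le hR h _ s q (by omega))
            (norm_nonneg _) hR
    _ = (r * R) ^ (k + 2) := by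
      rw [Finset.sum_const, Finset.card_univ, Fintype.card_fin, nsmul_eq_mul]
      ring

/-- The Taylor coefficient `P^{(k)}(μ)/k!`. -/
noncomputable def taylorCoeffAt (P : Matrix (Fin n) (Fin n) ℂ[X]) (μ : ℂ) (k : ℕ) :
    Matrix (Fin n) (Fin n) ℂ := (k.factorial : ℂ)⁻¹ • derivAt P k μ

theorem block_Qmat_eq_sum (A : Fin (m + 1) → Matrix (Fin n) (Fin n) ℂ) (μ : ℂ) (Γ : Params r)
    (i l : Fin r) : block (Qmat A (fun _ => μ) Γ) i l =
      ∑ k ∈ Finset.range r, (nilPart Γ ^ k) l i • taylorCoeffAt (matPoly A) μ k := by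
  ext a b
  rw [block_Qmat_apply, Matrix.sum_apply]
  rfl

theorem norm_block_Qmat_mulVec_le (A : Fin (m + 1) → Matrix (Fin n) (Fin n) ℂ) (μ : ℂ)
    (Γ : Params r) (s : Finset ℕ) {l i : Fin r} {R : ℝ}
    (h : ∀ k ∈ s, ‖(nilPart Γ ^ k) l i‖ ≤ R ^ k) (u : Fin n → ℂ) :
    ‖WithLp.toLp 2 ((∑ k ∈ s, (nilPart Γ ^ k) l i • taylorCoeffAt (matPoly A) μ k) *ᵥ u)‖ ≤
      (∑ k ∈ s, R ^ k * norm2 (taylorCoeffAt (matPoly A) μ k)) * ‖WithLp.toLp 2 u‖ := by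
  rw [Matrix.sum_mulVec, WithLp.toLp_sum, Finset.sum_mul]
  refine (norm_sum_le _ _).trans (Finset.sum_le_sum fun k hk => ?_)
  rw [smul_mulVec, WithLp.toLp_smul, norm_smul, mul_assoc]
  exact mul_le_mul (h k hk) (norm_mulVec_le_norm2 _ _) (norm_nonneg _)
    ((norm_nonneg _).trans (h k hk))

/-- Only finitely many shifts are singular. The shift is needed because `P(μ)`, the diagonal block
of `𝒬`, may be singular. -/
theorem exists_norm_le_and_isUnit_add_smul (Z : Matrix (Fin n) (Fin n) ℂ) {ε : ℝ} (hε : 0 < ε) :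
    ∃ δ : ℂ, ‖δ‖ ≤ ε ∧ IsUnit (Z + δ • (1 : Matrix (Fin n) (Fin n) ℂ)) := by
  have hinf : (Set.Ioc 0 ε).Infinite := Set.Ioc_infinite hε
  have hinf' : ((fun x : ℝ => (x : ℂ)) '' Set.Ioc 0 ε).Infinite :=
    hinf.image Complex.ofReal_injective.injOn
  obtain ⟨_, ⟨δ, hδ, rfl⟩, hroot⟩ := hinf'.exists_notMem_finset (-Z).charpoly.roots.toFinset
  refine ⟨δ, ?_, ?_⟩
  · rw [Complex.norm_real, Real.norm_of_nonneg hδ.1.le]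
    exact hδ.2
  · rw [Multiset.mem_toFinset, mem_roots (charpoly_monic _).ne_zero, IsRoot, eval_charpoly,
      sub_neg_eq_add] at hroot
    rw [Matrix.isUnit_iff_isUnit_det, isUnit_iff_ne_zero, smul_one_eq_diagonal, add_comm]
    exact hroot

theorem exists_pos_mul_norm_le_of_isUnit {D : Matrix (Fin n) (Fin n) ℂ} (hD : IsUnit D) :
    ∃ s : ℝ, 0 < s ∧ ∀ u, s * ‖WithLp.toLp 2 u‖ ≤ ‖WithLp.toLp 2 (D *ᵥ u)‖ := by
  have h0 : 0 ≤ norm2 D⁻¹ := norm_nonneg _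
  refine ⟨(norm2 D⁻¹ + 1)⁻¹, by positivity, fun u => ?_⟩
  rw [inv_mul_le_iff₀ (by positivity)]
  have h1 := norm_mulVec_le_norm2 D⁻¹ (D *ᵥ u)
  rw [mulVec_mulVec, nonsing_inv_mul _ ((Matrix.isUnit_iff_isUnit_det _).1 hD), one_mulVec] at h1
  nlinarith [norm_nonneg (WithLp.toLp 2 (D *ᵥ u))]

theorem isBlockLower_Qmat_add_smul (A : Fin (m + 1) → Matrix (Fin n) (Fin n) ℂ) (μ : ℂ)
    (Γ : Params r) (δ : ℂ) :
    IsBlockLower (Qmat A (fun _ => μ) Γ + δ • (1 : Matrix (Fin r × Fin n) (Fin r × Fin n) ℂ))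
      (derivAt (matPoly A) 0 μ + δ • 1) := by
  constructor
  · intro p q hpq
    have h := block_Qmat A μ Γ p q
    rw [if_neg hpq.not_gt, if_neg hpq.ne] at h
    ext a b
    have h1 := congrFun (congrFun h a) b
    simp only [block, Matrix.of_apply, Matrix.zero_apply] at h1
    simp [block, h1, hpq.ne]
  · intro p
    have h := block_Qmat A μ Γ p p
    rw [if_neg (lt_irrefl p), if_pos rfl] at h
    ext a b
    have h1 := congrFun (congrFun h a) b
    simp only [block, Matrix.of_apply] at h1
    simp [block, h1, Matrix.one_apply]

theorem block_Qmat_add_smul_of_ne (A : Fin (m + 1) → Matrix (Fin n) (Fin n) ℂ) (μ : ℂ)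
    (Γ : Params r) (δ : ℂ) {p q : Fin r} (hpq : p ≠ q) :
    block (Qmat A (fun _ => μ) Γ + δ • (1 : Matrix (Fin r × Fin n) (Fin r × Fin n) ℂ)) p q =
      ∑ k ∈ Finset.range r, (nilPart Γ ^ k) q p • taylorCoeffAt (matPoly A) μ k := by
  rw [← block_Qmat_eq_sum]
  ext a b
  simp [block, hpq]

/-- The inductive step on superdiagonals: block `(i, l)` stretches by at least `T = ‖γ‖ s - c'`,
where `c'` bounds the terms other than the `P'(μ)` one. The shift costs `ε/2`, so `σ_{-r} > ε`
leaves `ε/2 < r c ‖Z‖ / T`, which bounds `T`. -/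
theorem norm_nilPart_mul_le_of_lt_sigmaQ (hrn : r ≤ n)
    (A : Fin (m + 1) → Matrix (Fin n) (Fin n) ℂ) (μ : ℂ) {ε R s c c' : ℝ} (hε : 0 < ε)
    (hR : 0 ≤ R) {δ : ℂ} (hδ : ‖δ‖ ≤ ε / 2) {Z : Matrix (Fin n) (Fin n) ℂ}
    (hZδ : derivAt (matPoly A) 0 μ + δ • 1 = Z) (hZ : IsUnit Z)
    (hDs : ∀ u, s * ‖WithLp.toLp 2 u‖ ≤
      ‖WithLp.toLp 2 (taylorCoeffAt (matPoly A) μ 1 *ᵥ u)‖)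
    (hc : ∑ k ∈ Finset.range r, (r * R) ^ k * norm2 (taylorCoeffAt (matPoly A) μ k) ≤ c)
    (hZc : norm2 Z ≤ c)
    (hc' : ∑ k ∈ (Finset.range r).erase 1,
      (r * R) ^ k * norm2 (taylorCoeffAt (matPoly A) μ k) ≤ c')
    {Γ : Params r} (hΓ : ε < sigmaQ A r μ Γ) {d : ℕ}
    (hbound : ∀ p q : Fin r, (q : ℕ) < p + d → ‖nilPart Γ p q‖ ≤ R)
    {l i : Fin r} (hil : l < i) (heq : (i : ℕ) = l + d) :
    ‖nilPart Γ l i‖ * s ≤ c' + 2 * (r * c * norm2 Z) / ε := by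
  have hZn : 0 ≤ norm2 Z := norm_nonneg _
  have hc0 : 0 ≤ c := hZn.trans hZc
  rcases le_or_gt (‖nilPart Γ l i‖ * s - c') 0 with hT | hT
  · have : 0 ≤ 2 * (r * c * norm2 Z) / ε := by positivity
    linarith
  have hlow := isBlockLower_Qmat_add_smul A μ Γ δ
  rw [hZδ] at hlow
  have key := singVal_le_of_isBlockLower (Q := Qmat A (fun _ => μ) Γ) (δ := ε / 2) (c := c)
    hrn hlow hZ ?_ hil hc0 hT ?_ ?_
  · have h1 : ε < r * c * norm2 Z / (‖nilPart Γ l i‖ * s - c') + ε / 2 := hΓ.trans_le key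
    have h2 : ε / 2 < r * c * norm2 Z / (‖nilPart Γ l i‖ * s - c') := by linarith
    rw [lt_div_iff₀ hT] at h2
    have h3 : ‖nilPart Γ l i‖ * s - c' ≤ 2 * (r * c * norm2 Z) / ε := by
      rw [le_div_iff₀ hε]
      linarith
    linarith
  · intro x
    have h1 : Qmat A (fun _ => μ) Γ *ᵥ x =
        (Qmat A (fun _ => μ) Γ + δ • (1 : Matrix (Fin r × Fin n) (Fin r × Fin n) ℂ)) *ᵥ x -
          δ • x := by
      rw [add_mulVec, smul_mulVec, one_mulVec, add_sub_cancel_right]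
    conv_lhs => rw [h1]
    rw [WithLp.toLp_sub, WithLp.toLp_smul]
    refine (norm_sub_le _ _).trans ?_
    rw [norm_smul]
    gcongr
  · intro p hp u
    rcases lt_trichotomy p l with hpl | rfl | hpl
    · rw [hlow.upper p l hpl, zero_mulVec, WithLp.toLp_zero, norm_zero]
      positivity
    · rw [hlow.diag]
      refine (norm_mulVec_le_norm2 _ _).trans ?_
      gcongr
    · rw [block_Qmat_add_smul_of_ne A μ Γ δ hpl.ne']
      have hpi : (p : ℕ) < i := hp
      refine (norm_block_Qmat_mulVec_le A μ Γ (Finset.range r) (fun k _ =>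
        norm_nilPart_pow_apply_le hR hbound k l p (by omega)) u).trans ?_
      gcongr
  · intro u
    have h1r : 1 ∈ Finset.range r := by
      have h1 : (l : ℕ) < i := hil
      have h2 := i.2
      rw [Finset.mem_range]
      omega
    rw [block_Qmat_add_smul_of_ne A μ Γ δ hil.ne', ← Finset.add_sum_erase _ _ h1r, add_mulVec,
      WithLp.toLp_add, pow_one, smul_mulVec, WithLp.toLp_smul]
    have h1 := (norm_block_Qmat_mulVec_le A μ Γ ((Finset.range r).erase 1) (l := l) (i := i)
      (R := r * R) (fun k hk => by
        match k, Finset.ne_of_mem_erase hk with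
        | 0, _ =>
          rw [pow_zero, pow_zero, Matrix.one_apply_ne hil.ne, norm_zero]
          exact zero_le_one
        | k + 2, _ => exact norm_nilPart_pow_add_two_apply_le hR hbound k l i heq) u).trans
      (mul_le_mul_of_nonneg_right hc' (norm_nonneg _))
    refine le_trans ?_ (norm_sub_le_norm_add _ _)
    have h2 := mul_le_mul_of_nonneg_left (hDs u) (norm_nonneg (nilPart Γ l i))
    rw [norm_smul, sub_mul, mul_assoc]
    linarith

theorem exists_norm_nilPart_le_of_lt_sigmaQ (hrn : r ≤ n)
    (A : Fin (m + 1) → Matrix (Fin n) (Fin n) ℂ) (μ : ℂ)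
    (hD : IsUnit (taylorCoeffAt (matPoly A) μ 1)) {ε : ℝ} (hε : 0 < ε) (d : ℕ) :
    ∃ R : ℝ, 0 ≤ R ∧ ∀ Γ : Params r, ε < sigmaQ A r μ Γ →
      ∀ p q : Fin r, (q : ℕ) < p + d → ‖nilPart Γ p q‖ ≤ R := by
  induction d with
  | zero =>
    refine ⟨0, le_rfl, fun Γ _ p q hpq => ?_⟩
    have : q < p := by simpa using hpq
    rw [nilPart_apply_of_le Γ this.le, norm_zero]
  | succ d ih =>
    obtain ⟨R, hR, hbound⟩ := ih
    obtain ⟨δ, hδ, hZ⟩ := exists_norm_le_and_isUnit_add_smul (derivAt (matPoly A) 0 μ)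
      (half_pos hε)
    obtain ⟨s, hs, hDs⟩ := exists_pos_mul_norm_le_of_isUnit hD
    obtain ⟨Z, hZδ⟩ : ∃ Z, derivAt (matPoly A) 0 μ + δ • 1 = Z := ⟨_, rfl⟩
    rw [hZδ] at hZ
    obtain ⟨c', hc'⟩ : ∃ c', ∑ k ∈ (Finset.range r).erase 1,
        (r * R) ^ k * norm2 (taylorCoeffAt (matPoly A) μ k) ≤ c' := ⟨_, le_rfl⟩
    obtain ⟨c, hc, hZc⟩ : ∃ c, ∑ k ∈ Finset.range r,
        (r * R) ^ k * norm2 (taylorCoeffAt (matPoly A) μ k) ≤ c ∧ norm2 Z ≤ c :=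
      ⟨_, le_max_left _ _, le_max_right _ _⟩
    refine ⟨max R ((c' + 2 * (r * c * norm2 Z) / ε) / s), le_max_of_le_left hR,
      fun Γ hΓ l i hli => ?_⟩
    rcases Nat.lt_succ_iff_lt_or_eq.1 hli with hlt | heq
    · exact (hbound Γ hΓ l i hlt).trans (le_max_left _ _)
    by_cases hil : i ≤ l
    · rw [nilPart_apply_of_le Γ hil, norm_zero]
      exact le_max_of_le_left hR
    · refine le_max_of_le_right ((le_div_iff₀ hs).2 ?_)
      exact norm_nilPart_mul_le_of_lt_sigmaQ hrn A μ hε hR hδ hZδ hZ hDs hc hZc hc' hΓ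
        (hbound Γ hΓ) (not_le.1 hil) heq

theorem continuous_Qmat (A : Fin (m + 1) → Matrix (Fin n) (Fin n) ℂ) (μ : ℂ) :
    Continuous fun Γ : Params r => Qmat A (fun _ => μ) Γ := by
  have h1 : Continuous fun Γ : Params r => Cmat (fun _ => μ) Γ := by
    refine continuous_matrix fun i k => ?_
    by_cases hik : i = k
    · simp only [Cmat, Matrix.of_apply, hik, if_true]
      exact continuous_const
    · simp only [Cmat, Matrix.of_apply, hik, if_false]
      by_cases h : i < k
      · simp only [gam, h, dif_pos]
        exact continuous_apply _
      · simp only [gam, h, dif_neg, not_false_iff]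
        exact continuous_const
  refine continuous_matrix fun x y => ?_
  simp only [Qmat, Matrix.sum_apply, Matrix.kroneckerMap_apply, Matrix.transpose_apply]
  exact continuous_finsetSum _ fun j _ => ((h1.pow _).matrix_elem _ _).mul continuous_const

open scoped Matrix.Norms.L2Operator in
theorem continuous_singVal {ι : Type*} [Fintype ι] [DecidableEq ι] (k : ℕ) :
    Continuous fun M : Matrix ι ι ℂ => singVal M k := by
  refine (LipschitzWith.of_le_add (f := fun M : Matrix ι ι ℂ => singVal M k)
    fun M M' => ?_).continuous
  refine LinearMap.singularValues_le_add_of_norm_sub_le _ _ dist_nonneg fun x => ?_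
  rw [dist_eq_norm, cstar_norm_def, ← LinearMap.sub_apply, ← map_sub]
  exact (Matrix.toEuclideanCLM (n := ι) (𝕜 := ℂ) (M - M')).le_opNorm x

theorem continuous_sigmaQ (A : Fin (m + 1) → Matrix (Fin n) (Fin n) ℂ) (μ : ℂ) :
    Continuous fun Γ : Params r => sigmaQ A r μ Γ :=
  (continuous_singVal _).comp (continuous_Qmat A μ)

theorem exists_isOptimal (hrn : r ≤ n) (A : Fin (m + 1) → Matrix (Fin n) (Fin n) ℂ) (μ : ℂ)
    (hD : 1 < r → (derivAt (matPoly A) 1 μ).rank = n) : ∃ Γ : Params r, IsOptimal A r μ Γ := by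
  rcases le_or_gt r 1 with hr | hr
  · have : IsEmpty {p : Fin r × Fin r // p.2 < p.1} := ⟨fun p => by
      have h1 : (p.1.2 : ℕ) < p.1.1 := p.2
      have h2 := p.1.1.2
      omega⟩
    exact ⟨0, fun Γ' => (congrArg _ (Subsingleton.elim Γ' 0)).le⟩
  have hunit : IsUnit (taylorCoeffAt (matPoly A) μ 1) := by
    have h1 : taylorCoeffAt (matPoly A) μ 1 = derivAt (matPoly A) 1 μ := by simp [taylorCoeffAt]
    rw [h1]
    exact isUnit_of_rank_eq_card (by rw [hD hr, Fintype.card_fin])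
  by_cases h : ∃ Γ₀ : Params r, 0 < sigmaQ A r μ Γ₀
  · obtain ⟨Γ₀, h0⟩ := h
    -- Taking `d = r` covers every entry of `Γ`; the level is halved so that `Γ₀` lies strictly
    -- above it.
    obtain ⟨R, hR, hbound⟩ := exists_norm_nilPart_le_of_lt_sigmaQ hrn A μ hunit (half_pos h0) r
    have hmem : ∀ Γ : Params r, sigmaQ A r μ Γ₀ / 2 < sigmaQ A r μ Γ →
        Γ ∈ Metric.closedBall (0 : Params r) R := by
      intro Γ hΓ
      rw [mem_closedBall_zero_iff, pi_norm_le_iff_of_nonneg hR]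
      intro p
      have h1 := hbound Γ hΓ p.1.2 p.1.1 (by omega)
      simpa [nilPart, gam, p.2] using h1
    obtain ⟨Γ, -, hmax⟩ := (isCompact_closedBall (0 : Params r) R).exists_isMaxOn
      ⟨Γ₀, hmem Γ₀ (half_lt_self h0)⟩ (continuous_sigmaQ A μ).continuousOn
    refine ⟨Γ, fun Γ' => ?_⟩
    by_cases hΓ' : sigmaQ A r μ Γ₀ / 2 < sigmaQ A r μ Γ'
    · exact hmax (hmem Γ' hΓ')
    · exact (not_lt.1 hΓ').trans ((half_le_self h0.le).trans (hmax (hmem Γ₀ (half_lt_self h0))))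
  · push Not at h
    exact ⟨0, fun Γ' => (h Γ').trans (singVal_nonneg _ _)⟩

end MatPolyDist

open MatPolyDist in
theorem corollary3p4 (n m r : ℕ) (hr : 1 ≤ r) (A : Fin (m + 1) → Matrix (Fin n) (Fin n) ℂ)
    (hA : (A (Fin.last m)).rank = n) (μ : ℂ) :
    -- the singular value characterization, under the two assumptions at an optimal `Γ`
    ((∃ Γ : Params r, IsOptimal A r μ Γ ∧ MultiplicityAssumption A r μ Γ ∧
        LinIndepAssumption A r μ Γ) →
      distMult A r μ = ⨆ Γ : Params r, ENNReal.ofReal (sigmaQ A r μ Γ)) ∧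
    -- for `r ≤ n` an optimal `Γ` exists if `P'(μ)` has full rank
    (r ≤ n → (1 < r → (derivAt (matPoly A) 1 μ).rank = n) → ∃ Γ : Params r, IsOptimal A r μ Γ) ∧
    -- the blocks of `𝒬(μ,Γ,P)`
    (∀ (Γ : Params r) (i l : Fin r),
      block (Qmat A (fun _ => μ) Γ) i l =
        if l < i then offDiagBlock (matPoly A) μ Γ i l
        else if i = l then derivAt (matPoly A) 0 μ
        else 0) :=
  ⟨distMult_eq_iSup hr A μ, fun hrn hD => exists_isOptimal hrn A μ hD, block_Qmat A μ⟩
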